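/- Let $\Omega=(0,1)$, $T>0$ and $Q_T=\Omega\times(0,T)$. Let $H^1_{(0)}(\Omega)=\{z\in H^1(\Omega):z(0)=0\}$, with norm $\|z\|_{H^1_{(0)}(\Omega)}=\|\partial_x z\|_{L^2(\Omega)}$, and let $H^{-1}_{(0)}(\Omega)$ be its dual, with the dual norm; $L^2(\Omega)$ is embedded in $H^{-1}_{(0)}(\Omega)$ by $\langle f,z\rangle=\int_\Omega fz\,dx$. For $A\in L^\infty(Q_T)$ and $(\varphi_0,\varphi_1)\in L^2(\Omega)\times H^{-1}_{(0)}(\Omega)$ consider $$\partial_{tt}\varphi-\partial_{xx}\varphi+A\varphi=0\ \text{ in }Q_T,\qquad \varphi(0,t)=0,\ \ \partial_x\varphi(1,t)=0\ \text{ on }(0,T),\qquad (\varphi,\partial_t\varphi)(\cdot,0)=(\varphi_0,\varphi_1)\ \text{ in }\Omega. \qquad(\star)$$ For $g\in L^2(Q_T)$, a weak solution of the backward problem $$\partial_{tt}w-\partial_{xx}w+Aw=g\ \text{ in }Q_T,\qquad w(0,\cdot)=0,\ \ \partial_x w(1,\cdot)=0\ \text{ on }(0,T),\qquad (w,\partial_t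 w)(\cdot,T)=(0,0)$$ is a function $w\in C^0([0,T];H^1_{(0)}(\Omega))\cap C^1([0,T];L^2(\Omega))\cap H^2(0,T;H^{-1}_{(0)}(\Omega))$ with $(w,\partial_tw)(\cdot,T)=(0,0)$ such that, for a.e. $t\in(0,T)$, $$\langle\partial_{tt}w(\cdot,t),z\rangle_{H^{-1}_{(0)}(\Omega),H^1_{(0)}(\Omega)}+\int_\Omega\partial_xw\,\partial_xz\,dx+\int_\Omega Awz\,dx=\int_\Omega gz\,dx\qquad\forall z\in H^1_{(0)}(\Omega).$$ A solution of $(\star)$ in the sense of transposition is a function $\varphi\in L^2(Q_T)$ such that, for every $g\in L^2(Q_T)$, $$\int_{Q_T}\varphi g\,dx\,dt=\langle\varphi_1,w(\cdot,0)\rangle_{H^{-1}_{(0)}(\Omega),H^1_{(0)}(\Omega)}-\int_\Omega\varphi_0\,\partial_tw(\cdot,0)\,dx,$$ where $w$ is the weak solution of the backward problem with right-hand side $g$. Theorem. For every $T>0$ there is a constant $C=C(T)>0$ such that, for every $A\in L^\infty(Q_T)$ and every $(\varphi_0,\varphi_1)\in L^2(\Omega)\times H^{-1}_{(0)}(\Omega)$,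 problem $(\star)$ has a unique solution $\varphi$ in the sense of transposition; this solution belongs to $C^0([0,T];L^2(\Omega))\cap C^1([0,T];H^{-1}_{(0)}(\Omega))$, and for every $t\in[0,T]$ $$\|\varphi(\cdot,t)\|_{L^2(\Omega)}+\|\partial_t\varphi(\cdot,t)\|_{H^{-1}_{(0)}(\Omega)}\le C e^{C\sqrt{\|A\|_{L^\infty(Q_T)}}}\,\|(\varphi_0,\varphi_1)\|_{L^2(\Omega)\times H^{-1}_{(0)}(\Omega)},$$ where $\|(\varphi_0,\varphi_1)\|^2_{L^2(\Omega)\times H^{-1}_{(0)}(\Omega)}=\|\varphi_0\|^2_{L^2(\Omega)}+\|\varphi_1\|^2_{H^{-1}_{(0)}(\Omega)}$. -/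

import Mathlib

open MeasureTheory Set

open scoped ContDiff ENNReal

noncomputable section

namespace WaveTransposition

/-! ### Lebesgue spaces on `Ω = (0,1)` and `Q_T = Ω × (0,T)` -/

/-- Lebesgue measure on `Ω = (0,1)`. -/
abbrev volΩ : Measure ℝ := volume.restrict (Ioo (0 : ℝ) 1)

/-- Lebesgue measure on the time interval `(0,T)`. -/
abbrev volTime (T : ℝ) : Measure ℝ := volume.restrict (Ioo (0 : ℝ) T)

/-- Lebesgue measure on `Q_T = Ω × (0,T)`; points are written `(x, t)`. -/
abbrev volQ (T : ℝ) : Measure (ℝ × ℝ) := volΩ.prod (volTime T)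

/-- `L²(Ω)`. -/
abbrev L2Ω : Type := Lp ℝ 2 volΩ

/-- `L²(Q_T) = L²(0,T; L²(Ω))`. -/
abbrev L2Q (T : ℝ) : Type := Lp ℝ 2 (volQ T)

/-- `L^∞(Q_T)`. -/
abbrev LinftyQ (T : ℝ) : Type := Lp ℝ ∞ (volQ T)

instance : IsProbabilityMeasure volΩ :=
  ⟨by simp [volΩ]⟩

/-! ### Weak derivatives -/

/-- `η ∈ C_c^∞((a,b))`. -/
def IsTestFunction (a b : ℝ) (η : ℝ → ℝ) : Prop :=
  ContDiff ℝ ∞ η ∧ HasCompactSupport η ∧ tsupport η ⊆ Ioo a b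

/-- `v` is the weak (distributional) derivative of `u` on `(a,b)`, for functions with values in a
Banach space (used with integrable `u` and `v`). -/
def HasWeakDeriv {X : Type*} [NormedAddCommGroup X] [NormedSpace ℝ X] (a b : ℝ) (u v : ℝ → X) :
    Prop :=
  ∀ η : ℝ → ℝ, IsTestFunction a b η →
    ∫ s in Ioo a b, deriv η s • u s = -∫ s in Ioo a b, η s • v s

theorem IsTestFunction.integrable_smul {η : ℝ → ℝ} (hη : IsTestFunction 0 1 η) (f : L2Ω) :
    Integrable (fun s => η s • f s) volΩ := by
  have hf : Integrable (f : ℝ → ℝ) volΩ := (Lp.memLp f).integrable one_le_two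
  obtain ⟨C, hC⟩ := hη.2.1.exists_bound_of_continuous hη.1.continuous
  exact hf.bdd_smul C hη.1.continuous.aestronglyMeasurable (Filter.Eventually.of_forall hC)

theorem IsTestFunction.integrable_deriv_smul {η : ℝ → ℝ} (hη : IsTestFunction 0 1 η)
    (f : L2Ω) : Integrable (fun s => deriv η s • f s) volΩ := by
  have hf : Integrable (f : ℝ → ℝ) volΩ := (Lp.memLp f).integrable one_le_two
  have hc : Continuous (deriv η) := (contDiff_infty_iff_deriv.mp hη.1).2.continuous
  obtain ⟨C, hC⟩ := hη.2.1.deriv.exists_bound_of_continuous hc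
  exact hf.bdd_smul C hc.aestronglyMeasurable (Filter.Eventually.of_forall hC)

/-! ### The space `H¹_{(0)}(Ω)` -/

/-- The graph `{(z, ∂ₓz) : z ∈ H¹(Ω), z(0) = 0}`. The second component is the weak derivative of
the first, and the value at `0` is that of the continuous representative. -/
def H10Graph : Submodule ℝ (L2Ω × L2Ω) where
  carrier := {p | HasWeakDeriv 0 1 p.1 p.2 ∧
    ∃ u : ℝ → ℝ, ContinuousOn u (Icc 0 1) ∧ p.1 =ᵐ[volΩ] u ∧ u 0 = 0}
  zero_mem' := by
    refine ⟨fun η _ => ?_, 0, continuousOn_const, Lp.coeFn_zero ℝ 2 volΩ, rfl⟩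
    have h0 := Lp.coeFn_zero ℝ 2 volΩ
    rw [integral_congr_ae (g := 0), integral_congr_ae (g := 0)]
    · simp
    · filter_upwards [h0] with s _
      simp
    · filter_upwards [h0] with s _
      simp
  add_mem' := by
    rintro p q ⟨hp, u, hu, hpu, hu0⟩ ⟨hq, v, hv, hqv, hv0⟩
    refine ⟨fun η hη => ?_, u + v, hu.add hv, (Lp.coeFn_add p.1 q.1).trans (hpu.add hqv), by
      simp [hu0, hv0]⟩
    have e1 : ∫ s in Ioo (0 : ℝ) 1, deriv η s • (p + q).1 s
        = ∫ s in Ioo (0 : ℝ) 1, (deriv η s • p.1 s + deriv η s • q.1 s) := by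
      refine integral_congr_ae ?_
      filter_upwards [Lp.coeFn_add p.1 q.1] with s hs
      rw [Prod.fst_add, hs, Pi.add_apply, smul_add]
    have e2 : ∫ s in Ioo (0 : ℝ) 1, η s • (p + q).2 s
        = ∫ s in Ioo (0 : ℝ) 1, (η s • p.2 s + η s • q.2 s) := by
      refine integral_congr_ae ?_
      filter_upwards [Lp.coeFn_add p.2 q.2] with s hs
      rw [Prod.snd_add, hs, Pi.add_apply, smul_add]
    rw [e1, e2, integral_add (hη.integrable_deriv_smul _) (hη.integrable_deriv_smul _),
      integral_add (hη.integrable_smul _) (hη.integrable_smul _), hp η hη, hq η hη]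
    ring
  smul_mem' := by
    rintro c p ⟨hp, u, hu, hpu, hu0⟩
    refine ⟨fun η hη => ?_, c • u, hu.const_smul c,
      (Lp.coeFn_smul c p.1).trans (hpu.const_smul c), by simp [hu0]⟩
    have e1 : ∫ s in Ioo (0 : ℝ) 1, deriv η s • (c • p).1 s
        = ∫ s in Ioo (0 : ℝ) 1, c • (deriv η s • p.1 s) := by
      refine integral_congr_ae ?_
      filter_upwards [Lp.coeFn_smul c p.1] with s hs
      rw [Prod.smul_fst, hs, Pi.smul_apply, smul_comm]
    have e2 : ∫ s in Ioo (0 : ℝ) 1, η s • (c • p).2 s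
        = ∫ s in Ioo (0 : ℝ) 1, c • (η s • p.2 s) := by
      refine integral_congr_ae ?_
      filter_upwards [Lp.coeFn_smul c p.2] with s hs
      rw [Prod.smul_snd, hs, Pi.smul_apply, smul_comm]
    rw [e1, e2, integral_smul, integral_smul, hp η hη, smul_neg]

/-- `H¹_{(0)}(Ω) = {z ∈ H¹(Ω) : z(0) = 0}`. -/
def H10 : Type := ↥H10Graph

instance : AddCommGroup H10 := inferInstanceAs (AddCommGroup ↥H10Graph)

instance : Module ℝ H10 := inferInstanceAs (Module ℝ ↥H10Graph)

/-- The inclusion `H¹_{(0)}(Ω) → L²(Ω)`, as a linear map. -/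
def H10.toL2 : H10 →ₗ[ℝ] L2Ω := (LinearMap.fst ℝ L2Ω L2Ω).comp H10Graph.subtype

/-- The weak derivative `∂ₓ : H¹_{(0)}(Ω) → L²(Ω)`, as a linear map. -/
def H10.dx : H10 →ₗ[ℝ] L2Ω := (LinearMap.snd ℝ L2Ω L2Ω).comp H10Graph.subtype

/-- A function whose weak derivative vanishes is almost everywhere constant. -/
theorem ae_eq_const_of_weakDeriv_zero {f : ℝ → ℝ} (hf : IntegrableOn f (Ioo 0 1))
    (h : ∀ η : ℝ → ℝ, IsTestFunction 0 1 η → ∫ s in Ioo (0 : ℝ) 1, deriv η s * f s = 0) :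
    ∃ k : ℝ, ∀ᵐ x ∂volΩ, f x = k := by
  let χb : ContDiffBump (1 / 2 : ℝ) := ⟨1 / 8, 1 / 4, by norm_num, by norm_num⟩
  set χ : ℝ → ℝ := χb.normed volume with hχ
  have χsm : ContDiff ℝ ∞ χ := χb.contDiff_normed
  have χcs : HasCompactSupport χ := χb.hasCompactSupport_normed
  have χts : tsupport χ ⊆ Ioo 0 1 := by
    rw [hχ, χb.tsupport_normed_eq]
    intro x hx
    rw [Real.closedBall_eq_Icc] at hx
    have h1 : (1 / 2 : ℝ) - 1 / 4 ≤ x := hx.1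
    have h2 : x ≤ (1 / 2 : ℝ) + 1 / 4 := hx.2
    constructor <;> linarith
  have χint : ∫ x, χ x = 1 := χb.integral_normed
  have mulInt : ∀ g : ℝ → ℝ, ContDiff ℝ ∞ g → HasCompactSupport g →
      Integrable (fun s => g s * f s) volΩ := fun g hg hgc => by
    obtain ⟨C, hC⟩ := hgc.exists_bound_of_continuous hg.continuous
    exact Integrable.bdd_mul (c := C) hf hg.continuous.aestronglyMeasurable
      (Filter.Eventually.of_forall hC)
  refine ⟨∫ s in Ioo (0 : ℝ) 1, χ s * f s, ?_⟩
  set k := ∫ s in Ioo (0 : ℝ) 1, χ s * f s with hk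
  have key := isOpen_Ioo.ae_eq_zero_of_integral_contDiff_smul_eq_zero
    (U := Ioo (0 : ℝ) 1) (f := fun x => f x - k) (μ := volume)
    ((hf.sub (integrable_const k)).locallyIntegrableOn) ?_
  · rw [ae_restrict_iff' measurableSet_Ioo]
    filter_upwards [key] with x hx hx1
    linarith [hx hx1]
  intro ψ ψsm ψcs ψts
  set c := ∫ x, ψ x with hc
  let q : ℝ → ℝ := fun x => ψ x - c * χ x
  have qsm : ContDiff ℝ ∞ q := ψsm.sub (contDiff_const.mul χsm)
  have qc : Continuous q := qsm.continuous
  have ψi : Integrable ψ := ψsm.continuous.integrable_of_hasCompactSupport ψcs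
  have χi : Integrable χ := χsm.continuous.integrable_of_hasCompactSupport χcs
  have qint : ∫ x, q x = 0 := by
    simp only [q]
    rw [integral_sub ψi (χi.const_mul c), integral_const_mul, χint, ← hc]
    ring
  have qi : Integrable q := ψi.sub (χi.const_mul c)
  -- a compact interval containing the supports
  have hK : IsCompact (tsupport ψ ∪ tsupport χ ∪ {1 / 2}) :=
    (ψcs.isCompact.union χcs.isCompact).union isCompact_singleton
  have hKsub : tsupport ψ ∪ tsupport χ ∪ {1 / 2} ⊆ Ioo (0 : ℝ) 1 := by
    refine union_subset (union_subset ψts χts) ?_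
    rintro x rfl
    constructor <;> norm_num
  have hKne : (tsupport ψ ∪ tsupport χ ∪ {(1 / 2 : ℝ)}).Nonempty := ⟨1 / 2, by simp⟩
  obtain ⟨a, haK, ha⟩ := hK.exists_isLeast hKne
  obtain ⟨b, hbK, hb⟩ := hK.exists_isGreatest hKne
  have ha0 : 0 < a := (hKsub haK).1
  have hb1 : b < 1 := (hKsub hbK).2
  have qout : ∀ x, x ∉ Icc a b → q x = 0 := by
    intro x hx
    have hxK : x ∉ tsupport ψ ∪ tsupport χ ∪ {(1 / 2 : ℝ)} := fun hxK => hx ⟨ha hxK, hb hxK⟩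
    have h1 : ψ x = 0 := image_eq_zero_of_notMem_tsupport fun h' => hxK (Or.inl (Or.inl h'))
    have h2 : χ x = 0 := image_eq_zero_of_notMem_tsupport fun h' => hxK (Or.inl (Or.inr h'))
    simp [q, h1, h2]
  let η : ℝ → ℝ := fun x => ∫ y in (0 : ℝ)..x, q y
  have ηd : ∀ x, HasDerivAt η (q x) x := fun x =>
    intervalIntegral.integral_hasDerivAt_right (qc.intervalIntegrable _ _)
      (qc.stronglyMeasurableAtFilter _ _) qc.continuousAt
  have ηd' : deriv η = q := funext fun x => (ηd x).deriv
  have ηout : ∀ x, x ∉ Icc a b → η x = 0 := by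
    intro x hx
    have hcase : x < a ∨ b < x := by
      by_contra! hcon
      exact hx ⟨hcon.1, hcon.2⟩
    rcases hcase with hxa | hxb
    · have : ∫ y in (0 : ℝ)..x, q y = ∫ y in (0 : ℝ)..x, (0 : ℝ) := by
        refine intervalIntegral.integral_congr fun y hy => qout y fun hy' => ?_
        have : y ≤ max 0 x := hy.2
        have h3 : max 0 x < a := max_lt ha0 hxa
        linarith [hy'.1]
      simpa [η] using this
    · have hsupp : Function.support q ⊆ Ioc 0 x := by
        intro y hy
        by_contra hy2
        refine hy (qout y fun hy' => hy2 ⟨by linarith [hy'.1], by linarith [hy'.2]⟩)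
      have := intervalIntegral.integral_eq_integral_of_support_subset (μ := volume) hsupp
      simp only [η]
      rw [this, qint]
  have ηts : tsupport η ⊆ Icc a b := by
    refine closure_minimal (fun x hx => ?_) isClosed_Icc
    by_contra hx2
    exact hx (ηout x hx2)
  have ηtest : IsTestFunction 0 1 η := by
    refine ⟨contDiff_infty_iff_deriv.mpr ⟨fun x => (ηd x).differentiableAt, ηd' ▸ qsm⟩,
      isCompact_Icc.of_isClosed_subset (isClosed_tsupport η) ηts, ηts.trans fun x hx => ?_⟩
    exact ⟨by linarith [hx.1], by linarith [hx.2]⟩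
  have h0 := h η ηtest
  rw [ηd'] at h0
  have ψf := mulInt ψ ψsm ψcs
  have χf := mulInt χ χsm χcs
  have h1 : ∫ s in Ioo (0 : ℝ) 1, ψ s * f s = c * k := by
    have : ∫ s in Ioo (0 : ℝ) 1, q s * f s
        = (∫ s in Ioo (0 : ℝ) 1, ψ s * f s) - c * k := by
      rw [hk, ← integral_const_mul, ← integral_sub ψf (χf.const_mul c)]
      refine integral_congr_ae (Filter.Eventually.of_forall fun s => ?_)
      simp only [q]
      ring
    linarith
  have h2 : ∫ s in Ioo (0 : ℝ) 1, ψ s = c := by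
    rw [hc]
    refine setIntegral_eq_integral_of_forall_compl_eq_zero fun x hx => ?_
    exact image_eq_zero_of_notMem_tsupport fun h' => hx (ψts h')
  have h3 : ∫ x, ψ x • (f x - k) = ∫ x in Ioo (0 : ℝ) 1, ψ x • (f x - k) := by
    refine (setIntegral_eq_integral_of_forall_compl_eq_zero fun x hx => ?_).symm
    rw [image_eq_zero_of_notMem_tsupport fun h' => hx (ψts h'), zero_smul]
  have h4 : ∫ x in Ioo (0 : ℝ) 1, ψ x • (f x - k)
      = (∫ s in Ioo (0 : ℝ) 1, ψ s * f s) - (∫ s in Ioo (0 : ℝ) 1, ψ s) * k := by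
    rw [← integral_mul_const, ← integral_sub ψf (ψi.restrict.mul_const k)]
    refine integral_congr_ae (Filter.Eventually.of_forall fun s => ?_)
    simp only [smul_eq_mul]
    ring
  rw [h3, h4, h1, h2, sub_self]

/-- An element of `H¹_{(0)}(Ω)` is the primitive of its weak derivative vanishing at `0`. -/
theorem H10.ae_eq_primitive (z : H10) :
    ∀ᵐ x ∂volΩ, z.toL2 x = ∫ y in (0 : ℝ)..x, z.dx y := by
  obtain ⟨⟨z, d⟩, hw, u, hu, hzu, hu0⟩ := z
  change ∀ᵐ x ∂volΩ, z x = ∫ y in (0 : ℝ)..x, d y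
  change z =ᵐ[volΩ] u at hzu
  change HasWeakDeriv 0 1 z d at hw
  have zi : IntegrableOn z (Ioo 0 1) := (Lp.memLp z).integrable one_le_two
  have di : IntegrableOn d (Ioo 0 1) := (Lp.memLp d).integrable one_le_two
  have di' : IntervalIntegrable d volume 0 1 := by
    rw [intervalIntegrable_iff_integrableOn_Ioo_of_le zero_le_one]
    exact di
  set v : ℝ → ℝ := fun x => ∫ y in (0 : ℝ)..x, d y with hv
  have vac : AbsolutelyContinuousOnInterval v 0 1 :=
    di'.absolutelyContinuousOnInterval_intervalIntegral (by simp)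
  have vc : ContinuousOn v (Icc 0 1) := by
    have := vac.continuousOn
    rwa [uIcc_of_le zero_le_one] at this
  have vi : IntegrableOn v (Ioo 0 1) :=
    (vc.integrableOn_compact isCompact_Icc).mono_set Ioo_subset_Icc_self
  have toIoo : ∀ F : ℝ → ℝ, ∫ x in (0 : ℝ)..1, F x = ∫ x in Ioo (0 : ℝ) 1, F x := fun F => by
    rw [intervalIntegral.integral_of_le zero_le_one, integral_Ioc_eq_integral_Ioo]
  obtain ⟨k, hk⟩ := ae_eq_const_of_weakDeriv_zero (f := fun x => z x - v x) (zi.sub vi) (by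
    intro η hη
    have hηd : ContDiff ℝ ∞ (deriv η) := (contDiff_infty_iff_deriv.mp hη.1).2
    have ηac : AbsolutelyContinuousOnInterval η 0 1 :=
      (hη.1.of_le (by simp)).contDiffOn.absolutelyContinuousOnInterval
    have η0 : η 0 = 0 := image_eq_zero_of_notMem_tsupport fun h' => by simpa using hη.2.2 h'
    have η1 : η 1 = 0 := image_eq_zero_of_notMem_tsupport fun h' => by simpa using hη.2.2 h'
    have ibp := vac.integral_mul_deriv_eq_deriv_mul ηac
    have hdv : ∫ x in (0 : ℝ)..1, deriv v x * η x = ∫ x in (0 : ℝ)..1, d x * η x := by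
      refine intervalIntegral.integral_congr_ae ?_
      filter_upwards [di'.ae_hasDerivAt_integral] with x hx hx1
      rw [(hx (uIoc_subset_uIcc hx1) 0 (by simp)).deriv]
    rw [η0, η1, hdv, toIoo, toIoo] at ibp
    have hwη := hw η hη
    have hz : Integrable (fun s => deriv η s * z s) volΩ := hη.integrable_deriv_smul z
    have hvη : Integrable (fun s => deriv η s * v s) volΩ := by
      obtain ⟨C, hC⟩ := hη.2.1.deriv.exists_bound_of_continuous hηd.continuous
      exact Integrable.bdd_mul (c := C) vi hηd.continuous.aestronglyMeasurable
        (Filter.Eventually.of_forall hC)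
    simp only [mul_sub]
    rw [integral_sub hz hvη]
    simp only [smul_eq_mul] at hwη
    have c1 : ∫ x in Ioo (0 : ℝ) 1, v x * deriv η x
        = ∫ x in Ioo (0 : ℝ) 1, deriv η x * v x := by simp only [mul_comm]
    have c2 : ∫ x in Ioo (0 : ℝ) 1, d x * η x = ∫ x in Ioo (0 : ℝ) 1, η x * d x := by
      simp only [mul_comm]
    rw [hwη, ← c1, ibp, c2]
    ring)
  -- the continuous representative minus the primitive is constant, equal to its value at `0`
  have hEq : (fun x => u x - v x) =ᵐ[volΩ] fun _ => k := by
    filter_upwards [hk, hzu] with x h1 h2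
    rw [← h2, h1]
  have hEq2 : EqOn (fun x => u x - v x) (fun _ => k) (Ioo 0 1) :=
    Measure.eqOn_open_of_ae_eq hEq isOpen_Ioo
      ((hu.sub vc).mono Ioo_subset_Icc_self) continuousOn_const
  have hk0 : k = 0 := by
    have hcl : EqOn (fun x => u x - v x) (fun _ => k) (Icc 0 1) :=
      hEq2.of_subset_closure (hu.sub vc) continuousOn_const Ioo_subset_Icc_self
        (by rw [closure_Ioo (by norm_num)])
    have := hcl (left_mem_Icc.mpr zero_le_one)
    simpa [hu0, hv] using this.symm
  filter_upwards [hk] with x hx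
  have : z x - v x = 0 := by rw [hx, hk0]
  linarith

/-- Poincaré's inequality on `H¹_{(0)}(Ω)`. -/
theorem H10.norm_toL2_le (z : H10) : ‖z.toL2‖ ≤ ‖z.dx‖ := by
  have hb : ∀ᵐ x ∂volΩ, ‖z.toL2 x‖ ≤ ‖z.dx‖ := by
    have di : Integrable z.dx volΩ := (Lp.memLp z.dx).integrable one_le_two
    have h1 : ∫ x, ‖z.dx x‖ ∂volΩ ≤ ‖z.dx‖ := by
      rw [integral_norm_eq_lintegral_enorm di.aestronglyMeasurable, Lp.norm_def,
        ← eLpNorm_one_eq_lintegral_enorm]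
      exact ENNReal.toReal_mono (Lp.eLpNorm_ne_top _)
        (eLpNorm_le_eLpNorm_of_exponent_le one_le_two di.aestronglyMeasurable)
    have hmem : ∀ᵐ x ∂volΩ, x ∈ Ioo (0 : ℝ) 1 := ae_restrict_mem measurableSet_Ioo
    filter_upwards [z.ae_eq_primitive, hmem] with x hx hx1
    rw [hx, intervalIntegral.integral_of_le hx1.1.le]
    refine (norm_integral_le_integral_norm _).trans (le_trans ?_ h1)
    refine setIntegral_mono_set di.norm (Filter.Eventually.of_forall fun _ => norm_nonneg _) ?_
    exact Filter.Eventually.of_forall fun y hy => ⟨hy.1, hy.2.trans_lt hx1.2⟩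
  have h1 : measureUnivNNReal volΩ = 1 := by simp [measureUnivNNReal]
  have := Lp.norm_le_of_ae_bound (norm_nonneg z.dx) hb
  simpa [h1] using this

theorem H10.dx_injective : Function.Injective H10.dx := by
  rw [injective_iff_map_eq_zero]
  intro z hz
  have h1 : H10.toL2 z = 0 := by
    have := z.norm_toL2_le
    rw [hz, norm_zero] at this
    exact norm_le_zero_iff.mp this
  exact Subtype.ext (Prod.ext h1 hz)

/-- `H¹_{(0)}(Ω)` carries the norm `‖z‖ = ‖∂ₓ z‖_{L²(Ω)}`. -/
instance : NormedAddCommGroup H10 :=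
  NormedAddCommGroup.induced H10 L2Ω H10.dx H10.dx_injective

instance : NormedSpace ℝ H10 := NormedSpace.induced ℝ H10 L2Ω H10.dx

theorem H10.norm_def (z : H10) : ‖z‖ = ‖z.dx‖ := rfl

/-- `H^{-1}_{(0)}(Ω)`, the dual of `H¹_{(0)}(Ω)`, with the dual norm. -/
abbrev Hm1 : Type := H10 →L[ℝ] ℝ

/-- The continuous inclusion `H¹_{(0)}(Ω) → L²(Ω)`. -/
def H10.inclL2 : H10 →L[ℝ] L2Ω :=
  H10.toL2.mkContinuous 1 fun z => by
    rw [one_mul]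
    exact z.norm_toL2_le

/-- The inclusion `L²(Ω) → H^{-1}_{(0)}(Ω)`, `⟨f, z⟩ = ∫_Ω f z dx`. -/
def L2Ω.toHm1 (f : L2Ω) : Hm1 := (innerSL ℝ f).comp H10.inclL2

/-! ### The backward adjoint problem -/

/-- `w ∈ C⁰([0,T]; H¹_{(0)}(Ω)) ∩ C¹([0,T]; L²(Ω))`, with time derivative `wt`, is a weak solution
of `∂ₜₜ w - ∂ₓₓ w + A w = g` in `Q_T`, `w(0,·) = 0`, `∂ₓ w(1,·) = 0`,
`(w(·,T), ∂ₜ w(·,T)) = (0,0)`. Only the values on `[0,T]` matter. The second time derivative `wtt`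
is the weak derivative of `wt` in `L²(0,T; H^{-1}_{(0)}(Ω))`. -/
structure IsBackwardWeakSolution (T : ℝ) (A : LinftyQ T) (g : L2Q T)
    (w : ℝ → H10) (wt : ℝ → L2Ω) : Prop where
  continuousOn : ContinuousOn w (Icc 0 T)
  continuousOn_deriv : ContinuousOn wt (Icc 0 T)
  hasDerivWithinAt : ∀ t ∈ Icc 0 T,
    HasDerivWithinAt (fun s => H10.inclL2 (w s)) (wt t) (Icc 0 T) t
  variational : ∃ wtt : ℝ → Hm1, MemLp wtt 2 (volTime T) ∧
    HasWeakDeriv 0 T (fun t => L2Ω.toHm1 (wt t)) wtt ∧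
    ∀ᵐ t ∂volTime T, ∀ z : H10,
      wtt t z + (∫ x, (w t).dx x * z.dx x ∂volΩ)
          + (∫ x, A (x, t) * (w t).toL2 x * z.toL2 x ∂volΩ)
        = ∫ x, g (x, t) * z.toL2 x ∂volΩ
  final : w T = 0
  final_deriv : wt T = 0

/-! ### Solutions in the sense of transposition -/

/-- `φ ∈ L²(0,T; L²(Ω))` is a solution in the sense of transposition of
`∂ₜₜ φ - ∂ₓₓ φ + A φ = B` in `Q_T`, `φ(0,·) = 0`, `∂ₓ φ(1,·) = 0`,
`(φ(·,0), ∂ₜ φ(·,0)) = (φ₀, φ₁)`. -/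
def IsTranspositionSolution (T : ℝ) (A : LinftyQ T) (B : L2Q T) (φ₀ : L2Ω) (φ₁ : Hm1)
    (φ : L2Q T) : Prop :=
  ∀ (g : L2Q T) (w : ℝ → H10) (wt : ℝ → L2Ω), IsBackwardWeakSolution T A g w wt →
    ∫ p, φ p * g p ∂volQ T
      = (∫ t, ∫ x, B (x, t) * (w t).toL2 x ∂volΩ ∂volTime T)
        + φ₁ (w 0) - ∫ x, φ₀ x * wt 0 x ∂volΩ

/-- `φ ∈ C⁰([0,T]; L²(Ω)) ∩ C¹([0,T]; H^{-1}_{(0)}(Ω))`: `u t` and `ut t` are the values of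
`φ(·,t)` and `∂ₜφ(·,t)` for `t ∈ [0,T]`. -/
structure IsContinuousRepresentative (T : ℝ) (φ : L2Q T) (u : ℝ → L2Ω) (ut : ℝ → Hm1) :
    Prop where
  ae_eq : ∀ᵐ t ∂volTime T, ∀ᵐ x ∂volΩ, φ (x, t) = u t x
  continuousOn : ContinuousOn u (Icc 0 T)
  continuousOn_deriv : ContinuousOn ut (Icc 0 T)
  hasDerivWithinAt : ∀ t ∈ Icc 0 T,
    HasDerivWithinAt (fun s => L2Ω.toHm1 (u s)) (ut t) (Icc 0 T) t

end WaveTransposition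

end

/-!
Through `∂ₓ` and the Riesz map, `H¹_{(0)}(Ω)` and `H^{-1}_{(0)}(Ω)` are copies of `L²(Ω)`. With `J`
the primitive vanishing at `0` and the state `Y = (φ, J† ∂ₜφ)`, the wave equation without potential
reads `∂ₜ(B Y) = Y` for the bounded skew-adjoint operator `B (φ, r) = (-J r, J† φ)`, whose inverse
generates a unitary group `U`. Weak solutions of the backward problem are exactly the mild solutions
for `U`, so by duality `φ` is a transposition solution if and only if `φ = U Y₀ - D (A φ)`, where
the Duhamel operator `D` has a kernel of norm at most `t - s`. This kernel integrates twice, so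
Gronwall's inequality for it involves the weight `exp (2 √‖A‖ t)`; a first order energy
estimate would only give an exponential of `‖A‖`.
-/

noncomputable section

namespace WaveTransposition

open Filter Topology
open scoped RealInnerProductSpace InnerProduct

/-! ### The unitary group generated by the inverse of a skew-adjoint operator -/

section Yosida

theorem commute_ringInverse_right {M : Type*} [MonoidWithZero M] {a b : M} (h : Commute a b) :
    Commute a (Ring.inverse b) := by
  by_cases hb : IsUnit b
  · obtain ⟨u, rfl⟩ := hb
    simpa only [Ring.inverse_unit] using h.units_inv_right
  · simp only [Ring.inverse_non_unit b hb, Commute.zero_right]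

variable {E : Type*} [NormedAddCommGroup E] [NormedSpace ℝ E]

/-- The regularised inverse `(ε - B²)⁻¹` of `-B²`; for `ε ≤ 0` it may take the junk value `0` of
`Ring.inverse`. -/
def regInv (B : E →L[ℝ] E) (ε : ℝ) : E →L[ℝ] E :=
  Ring.inverse (ε • (1 : E →L[ℝ] E) - B * B)

theorem commute_regInv (B : E →L[ℝ] E) (ε : ℝ) : Commute B (regInv B ε) :=
  commute_ringInverse_right <| ((Commute.one_right B).smul_right ε).sub_right
    ((Commute.refl B).mul_right (Commute.refl B))

theorem commute_regInv_regInv (B : E →L[ℝ] E) (ε δ : ℝ) :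
    Commute (regInv B ε) (regInv B δ) :=
  commute_ringInverse_right <| ((Commute.one_right _).smul_right δ).sub_right
    ((commute_regInv B ε).symm.mul_right (commute_regInv B ε).symm)

/-- The Yosida approximation `-B (ε - B²)⁻¹`, `ε = 1 / (n + 1)`, of the unbounded operator
`B⁻¹`. -/
def yosida (B : E →L[ℝ] E) (n : ℕ) : E →L[ℝ] E := -(B * regInv B (1 / ((n : ℝ) + 1)))

theorem commute_yosida (B : E →L[ℝ] E) (n : ℕ) : Commute (yosida B n) B :=
  ((Commute.refl B).mul_left (commute_regInv B _).symm).neg_left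

theorem commute_yosida_yosida (B : E →L[ℝ] E) (m n : ℕ) :
    Commute (yosida B m) (yosida B n) :=
  ((commute_yosida B m).mul_right
    (((commute_regInv B _).mul_left (commute_regInv_regInv B _ _)).neg_left)).neg_right

end Yosida

section UnitaryGroup

variable {E : Type*} [NormedAddCommGroup E] [InnerProductSpace ℝ E] [CompleteSpace E]
  {B S R : E →L[ℝ] E}

theorem inner_apply_left_of_mem_skewAdjoint (hB : B ∈ skewAdjoint (E →L[ℝ] E)) (x y : E) :
    ⟪B x, y⟫ = -⟪x, B y⟫ := by
  have h : B† = -B := skewAdjoint.mem_iff.mp hB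
  rw [← ContinuousLinearMap.adjoint_inner_right, h, _root_.neg_apply, inner_neg_right]

theorem denseRange_of_mem_skewAdjoint (hB : B ∈ skewAdjoint (E →L[ℝ] E))
    (hinj : Function.Injective B) : DenseRange B := by
  have h : B† = -B := skewAdjoint.mem_iff.mp hB
  have hbot : B.rangeᗮ = ⊥ := by
    rw [B.orthogonal_range, h, Submodule.eq_bot_iff]
    intro x hx
    exact hinj (by simpa using hx)
  have hdense := Submodule.dense_iff_topologicalClosure_eq_top.mpr
    (Submodule.topologicalClosure_eq_top_iff.mpr hbot)
  simpa only [DenseRange, LinearMap.coe_range, ContinuousLinearMap.coe_coe] using hdense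

theorem exp_add_apply_of_commute (h : Commute S R) (x : E) :
    NormedSpace.exp (S + R) x = NormedSpace.exp S (NormedSpace.exp R x) := by
  let _ : NormedAlgebra ℚ (E →L[ℝ] E) := NormedAlgebra.restrictScalars ℚ ℝ _
  rw [NormedSpace.exp_add_of_commute h, mul_apply_eq_comp]

theorem hasDerivAt_exp_smul_apply (S : E →L[ℝ] E) (x : E) (t : ℝ) :
    HasDerivAt (fun s : ℝ => NormedSpace.exp (s • S) x) (NormedSpace.exp (t • S) (S x)) t :=
  (ContinuousLinearMap.apply ℝ E x).hasFDerivAt.comp_hasDerivAt t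
    (hasDerivAt_exp_smul_const (𝕂 := ℝ) S t)

theorem norm_exp_smul_apply_of_mem_skewAdjoint (hS : S ∈ skewAdjoint (E →L[ℝ] E)) (t : ℝ)
    (x : E) : ‖NormedSpace.exp (t • S) x‖ = ‖x‖ := by
  let _ : NormedAlgebra ℚ (E →L[ℝ] E) := NormedAlgebra.restrictScalars ℚ ℝ _
  have hskew : t • S ∈ skewAdjoint (E →L[ℝ] E) := skewAdjoint.smul_mem t hS
  have hunit : NormedSpace.exp (t • S) ∈ unitary (E →L[ℝ] E) :=
    NormedSpace.exp_mem_unitary_of_mem_skewAdjoint hskew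
  exact ContinuousLinearMap.norm_map_of_mem_unitary hunit x

theorem norm_exp_smul_sub_exp_smul_le (hS : S ∈ skewAdjoint (E →L[ℝ] E))
    (hR : R ∈ skewAdjoint (E →L[ℝ] E)) (hSR : Commute S R) (t : ℝ) (x : E) :
    ‖NormedSpace.exp (t • S) x - NormedSpace.exp (t • R) x‖ ≤ ‖S x - R x‖ * |t| := by
  have hmv : ‖NormedSpace.exp (t • (S - R)) x - NormedSpace.exp ((0 : ℝ) • (S - R)) x‖
      ≤ ‖(S - R) x‖ * ‖t - 0‖ :=
    convex_univ.norm_image_sub_le_of_norm_hasDerivWithin_le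
      (fun s _ => (hasDerivAt_exp_smul_apply (S - R) x s).hasDerivWithinAt)
      (fun s _ => (norm_exp_smul_apply_of_mem_skewAdjoint (sub_mem hS hR) s _).le)
      (mem_univ _) (mem_univ _)
  have hc : Commute (t • R) (t • (S - R)) :=
    ((hSR.symm.sub_right (Commute.refl R)).smul_left t).smul_right t
  have hexp : NormedSpace.exp (t • S) x
      = NormedSpace.exp (t • R) (NormedSpace.exp (t • (S - R)) x) := by
    rw [← exp_add_apply_of_commute hc, ← smul_add, add_sub_cancel]
  rw [hexp, ← map_sub, norm_exp_smul_apply_of_mem_skewAdjoint hR]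
  simpa using hmv

theorem isSelfAdjoint_regInv (hB : B ∈ skewAdjoint (E →L[ℝ] E)) (ε : ℝ) :
    IsSelfAdjoint (regInv B ε) := by
  refine IsSelfAdjoint.ringInverse ?_
  rw [isSelfAdjoint_iff, star_sub, star_smul, star_one, star_mul, skewAdjoint.mem_iff.mp hB,
    neg_mul_neg, star_trivial]

theorem inner_regularised_apply_self (hB : B ∈ skewAdjoint (E →L[ℝ] E)) (ε : ℝ) (x : E) :
    ⟪(ε • (1 : E →L[ℝ] E) - B * B) x, x⟫ = ε * ‖x‖ ^ 2 + ‖B x‖ ^ 2 := by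
  change ⟪ε • x - B (B x), x⟫ = _
  rw [inner_sub_left, real_inner_smul_left, inner_apply_left_of_mem_skewAdjoint hB,
    real_inner_self_eq_norm_sq, real_inner_self_eq_norm_sq, sub_neg_eq_add]

theorem isUnit_smul_one_sub_mul_self (hB : B ∈ skewAdjoint (E →L[ℝ] E)) {ε : ℝ} (hε : 0 < ε) :
    IsUnit (ε • (1 : E →L[ℝ] E) - B * B) := by
  refine ContinuousLinearMap.isUnit_of_forall_le_norm_inner_map _ (c := ⟨ε, hε.le⟩) hε
    fun x => ?_
  rw [inner_regularised_apply_self hB, Real.norm_of_nonneg (by positivity)]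
  change ‖x‖ ^ 2 * ε ≤ _
  linarith [sq_nonneg ‖B x‖]

theorem regInv_apply_apply_apply (hB : B ∈ skewAdjoint (E →L[ℝ] E)) {ε : ℝ} (hε : 0 < ε)
    (x : E) : regInv B ε (B (B x)) = ε • regInv B ε x - x := by
  have h := DFunLike.congr_fun (Ring.inverse_mul_cancel _ (isUnit_smul_one_sub_mul_self hB hε)) x
  change regInv B ε (ε • x - B (B x)) = x at h
  rw [map_sub, map_smul] at h
  rw [eq_sub_iff_add_eq', ← eq_sub_iff_add_eq, h]

theorem norm_smul_regInv_apply_le (hB : B ∈ skewAdjoint (E →L[ℝ] E)) {ε : ℝ} (hε : 0 < ε)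
    (x : E) : ‖ε • regInv B ε x‖ ≤ ‖x‖ := by
  set y := regInv B ε x
  have hx : (ε • (1 : E →L[ℝ] E) - B * B) y = x :=
    DFunLike.congr_fun (Ring.mul_inverse_cancel _ (isUnit_smul_one_sub_mul_self hB hε)) x
  have h1 : ε * ‖y‖ ^ 2 ≤ ‖x‖ * ‖y‖ := by
    have h := inner_regularised_apply_self hB ε y
    rw [hx] at h
    linarith [real_inner_le_norm x y, sq_nonneg ‖B y‖]
  rw [norm_smul, Real.norm_of_nonneg hε.le]
  rcases (norm_nonneg y).eq_or_lt with h0 | h0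
  · simp [← h0]
  · exact le_of_mul_le_mul_right (by linarith [sq ‖y‖]) h0

theorem tendsto_smul_regInv_apply (hB : B ∈ skewAdjoint (E →L[ℝ] E))
    (hinj : Function.Injective B) (x : E) :
    Tendsto (fun n : ℕ => (1 / ((n : ℝ) + 1)) • regInv B (1 / ((n : ℝ) + 1)) x) atTop (𝓝 0) := by
  set ε : ℕ → ℝ := fun n => 1 / ((n : ℝ) + 1)
  have hε : ∀ n, 0 < ε n := fun n => Nat.one_div_pos_of_nat
  have hbound : ∃ C, ∀ n x, ‖(ε n • regInv B (ε n)) x‖ ≤ C * ‖x‖ :=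
    ⟨1, fun n x => (one_mul ‖x‖).symm ▸ norm_smul_regInv_apply_le hB (hε n) x⟩
  have heq := ((NormedSpace.equicontinuous_TFAE fun n => ε n • regInv B (ε n)).out 3 1).mp hbound
  have hdense : DenseRange (B ∘ B) :=
    have h := denseRange_of_mem_skewAdjoint hB hinj
    h.comp h B.continuous
  refine hdense.induction_on (p := fun x => Tendsto (fun n => ε n • regInv B (ε n) x) atTop (𝓝 0))
    x (heq.isClosed_setOfPred_tendsto continuous_const) fun y => ?_
  have hlim : Tendsto (fun n => ε n * (‖y‖ + ‖y‖)) atTop (𝓝 0) := by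
    simpa only [zero_mul] using
      (tendsto_one_div_add_atTop_nhds_zero_nat (𝕜 := ℝ)).mul_const (‖y‖ + ‖y‖)
  refine squeeze_zero_norm (fun n => ?_) hlim
  rw [Function.comp_apply, regInv_apply_apply_apply hB (hε n), norm_smul,
    Real.norm_of_nonneg (hε n).le]
  exact mul_le_mul_of_nonneg_left ((norm_sub_le _ _).trans
    (add_le_add_left (norm_smul_regInv_apply_le hB (hε n) y) _)) (hε n).le

theorem yosida_mem_skewAdjoint (hB : B ∈ skewAdjoint (E →L[ℝ] E)) (n : ℕ) :
    yosida B n ∈ skewAdjoint (E →L[ℝ] E) := by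
  rw [skewAdjoint.mem_iff, yosida, star_neg, star_mul, skewAdjoint.mem_iff.mp hB,
    (isSelfAdjoint_regInv hB _).star_eq, mul_neg, (commute_regInv B _).eq]

theorem tendsto_yosida_apply (hB : B ∈ skewAdjoint (E →L[ℝ] E)) (hinj : Function.Injective B)
    (x : E) : Tendsto (fun n => yosida B n (B x)) atTop (𝓝 x) := by
  have h : ∀ n : ℕ, yosida B n (B x)
      = x - (1 / ((n : ℝ) + 1)) • regInv B (1 / ((n : ℝ) + 1)) x := fun n => by
    change -(B (regInv B _ (B x))) = _
    rw [← mul_apply_eq_comp, (commute_regInv B _).eq, mul_apply_eq_comp,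
      regInv_apply_apply_apply hB Nat.one_div_pos_of_nat, neg_sub]
  simp only [h]
  simpa only [sub_zero] using tendsto_const_nhds.sub (tendsto_smul_regInv_apply hB hinj x)

theorem uniformCauchySeqOn_exp_yosida (hB : B ∈ skewAdjoint (E →L[ℝ] E))
    (hinj : Function.Injective B) (x : E) (M : ℝ) :
    UniformCauchySeqOn (fun n (t : ℝ) => NormedSpace.exp (t • yosida B n) x) atTop
      (Metric.closedBall 0 M) := by
  rw [Metric.uniformCauchySeqOn_iff]
  intro η hη
  obtain ⟨y, hy⟩ :=
    (denseRange_of_mem_skewAdjoint hB hinj).exists_dist_lt x (show 0 < η / 4 by positivity)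
  obtain ⟨N, hN⟩ := Metric.cauchySeq_iff.mp (tendsto_yosida_apply hB hinj y).cauchySeq
    (η / (2 * (|M| + 1))) (by positivity)
  refine ⟨N, fun m hm n hn t ht => ?_⟩
  set V : ℕ → E →L[ℝ] E := fun n => NormedSpace.exp (t • yosida B n)
  have hnorm : ∀ n z, ‖V n z‖ = ‖z‖ := fun n z =>
    norm_exp_smul_apply_of_mem_skewAdjoint (yosida_mem_skewAdjoint hB n) t z
  have htM : |t| ≤ |M| + 1 := by
    rw [mem_closedBall_zero_iff, Real.norm_eq_abs] at ht
    linarith [le_abs_self M]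
  have hrange : ‖V m (B y) - V n (B y)‖ ≤ η / 2 := by
    refine (norm_exp_smul_sub_exp_smul_le (yosida_mem_skewAdjoint hB m)
      (yosida_mem_skewAdjoint hB n) (commute_yosida_yosida B m n) t (B y)).trans ?_
    calc _ ≤ η / (2 * (|M| + 1)) * (|M| + 1) := by
          gcongr
          exact (dist_eq_norm (yosida B m (B y)) _ ▸ hN m hm n hn).le
      _ = η / 2 := by field_simp
  calc dist (V m x) (V n x)
      ≤ dist (V m x) (V m (B y)) + dist (V m (B y)) (V n (B y)) + dist (V n (B y)) (V n x) :=
        dist_triangle4 _ _ _ _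
    _ < η := by
        rw [dist_eq_norm, dist_eq_norm, dist_eq_norm, ← map_sub, ← map_sub, hnorm, hnorm]
        rw [dist_eq_norm] at hy
        rw [norm_sub_rev (B y) x]
        linarith

/-- `U` is a strongly continuous group of isometries whose generator is the inverse of `B`: that
`B⁻¹` generates it is the last condition `d/dt U(t) B x = U(t) x`. -/
structure IsUnitaryGroup (B : E →L[ℝ] E) (U : ℝ → E →L[ℝ] E) : Prop where
  norm_map : ∀ t x, ‖U t x‖ = ‖x‖
  map_zero : ∀ x, U 0 x = x
  map_add : ∀ s t x, U (s + t) x = U s (U t x)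
  comm : ∀ t x, U t (B x) = B (U t x)
  continuous : ∀ x, Continuous fun t => U t x
  hasDerivAt : ∀ x t, HasDerivAt (fun s => U s (B x)) (U t x) t

theorem exists_tendstoLocallyUniformly_exp_yosida (hB : B ∈ skewAdjoint (E →L[ℝ] E))
    (hinj : Function.Injective B) :
    ∃ U : ℝ → E →L[ℝ] E, ∀ x, TendstoLocallyUniformly
      (fun n (t : ℝ) => NormedSpace.exp (t • yosida B n) x) (fun t => U t x) atTop := by
  have hex : ∀ (t : ℝ) (x : E), ∃ y,
      Tendsto (fun n => NormedSpace.exp (t • yosida B n) x) atTop (𝓝 y) := fun t x =>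
    cauchySeq_tendsto_of_complete <|
      (uniformCauchySeqOn_exp_yosida hB hinj x |t|).cauchySeq (by simp)
  choose W hW using hex
  refine ⟨fun t => continuousLinearMapOfTendsto _ (tendsto_pi_nhds.mpr (hW t)), fun x => ?_⟩
  rw [tendstoLocallyUniformly_iff_forall_isCompact]
  intro K hK
  obtain ⟨M, hM⟩ := hK.isBounded.subset_closedBall 0
  exact ((uniformCauchySeqOn_exp_yosida hB hinj x M).tendstoUniformlyOn_of_tendsto
    fun t _ => hW t x).mono hM

theorem hasDerivAt_of_tendstoLocallyUniformly_exp_yosida (hB : B ∈ skewAdjoint (E →L[ℝ] E))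
    (hinj : Function.Injective B) {U : ℝ → E →L[ℝ] E}
    (hU : ∀ x, TendstoLocallyUniformly
      (fun n (t : ℝ) => NormedSpace.exp (t • yosida B n) x) (fun t => U t x) atTop)
    (x : E) (t : ℝ) : HasDerivAt (fun s => U s (B x)) (U t x) t := by
  set V : ℕ → ℝ → E →L[ℝ] E := fun n t => NormedSpace.exp (t • yosida B n)
  have hshift : TendstoUniformly (fun n (s : ℝ) => V n s (yosida B n (B x) - x)) 0 atTop := by
    rw [Metric.tendstoUniformly_iff]
    intro η hη
    filter_upwards [(tendsto_iff_norm_sub_tendsto_zero.mp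
      (tendsto_yosida_apply hB hinj x)).eventually_lt_const hη] with n hn s
    rwa [Pi.zero_apply, dist_zero_left,
      norm_exp_smul_apply_of_mem_skewAdjoint (yosida_mem_skewAdjoint hB n)]
  have hderiv : TendstoLocallyUniformly (fun n (s : ℝ) => V n s (yosida B n (B x)))
      (fun s => U s x) atTop :=
    ((hshift.tendstoLocallyUniformly.add (hU x)).congr fun n s => by
      simp only [Pi.add_apply, map_sub, V, sub_add_cancel]).congr_right fun s => by simp
  exact hasDerivAt_of_tendstoLocallyUniformlyOn isOpen_univ
    (tendstoLocallyUniformlyOn_univ.mpr hderiv)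
    (Eventually.of_forall fun n s _ => hasDerivAt_exp_smul_apply _ (B x) s)
    (fun s _ => (tendstoLocallyUniformlyOn_univ.mpr (hU (B x))).tendsto_at (mem_univ s))
    (mem_univ t)

theorem exists_isUnitaryGroup (hB : B ∈ skewAdjoint (E →L[ℝ] E))
    (hinj : Function.Injective B) : ∃ U : ℝ → E →L[ℝ] E, IsUnitaryGroup B U := by
  obtain ⟨U, hU⟩ := exists_tendstoLocallyUniformly_exp_yosida hB hinj
  set V : ℕ → ℝ → E →L[ℝ] E := fun n t => NormedSpace.exp (t • yosida B n)
  have hV : ∀ t x, Tendsto (fun n => V n t x) atTop (𝓝 (U t x)) := fun t x =>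
    (tendstoLocallyUniformlyOn_univ.mpr (hU x)).tendsto_at (mem_univ t)
  have hnorm : ∀ n t x, ‖V n t x‖ = ‖x‖ := fun n =>
    norm_exp_smul_apply_of_mem_skewAdjoint (yosida_mem_skewAdjoint hB n)
  have hmoving : ∀ {t : ℝ} {y : ℕ → E} {x : E}, Tendsto y atTop (𝓝 x) →
      Tendsto (fun n => V n t (y n) - V n t x) atTop (𝓝 0) := fun {t y x} hy => by
    rw [tendsto_zero_iff_norm_tendsto_zero]
    simpa only [← map_sub, hnorm] using tendsto_iff_norm_sub_tendsto_zero.mp hy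
  refine ⟨U, fun t x => ?_, fun x => ?_, fun s t x => ?_, fun t x => ?_, fun x => ?_,
    fun x t => ?_⟩
  · exact tendsto_nhds_unique (hV t x).norm (by simp only [hnorm, tendsto_const_nhds])
  · exact tendsto_nhds_unique (hV 0 x) (by simp [V])
  · refine tendsto_nhds_unique (hV (s + t) x) ?_
    have hadd : ∀ n, V n (s + t) x = V n s (V n t x) := fun n => by
      simp only [V, add_smul]
      exact exp_add_apply_of_commute (((Commute.refl _).smul_left s).smul_right t) x
    simpa only [hadd, sub_add_cancel, zero_add] using (hmoving (t := s) (hV t x)).add (hV s (U t x))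
  · refine tendsto_nhds_unique (hV t (B x)) ?_
    have hcomm : ∀ n, V n t (B x) = B (V n t x) := fun n =>
      DFunLike.congr_fun (((commute_yosida B n).smul_left t).exp_left).eq x
    simpa only [hcomm, Function.comp_def] using (B.continuous.tendsto _).comp (hV t x)
  · exact (hU x).continuous (Frequently.of_forall fun n =>
      continuous_iff_continuousAt.mpr fun t => (hasDerivAt_exp_smul_apply _ x t).continuousAt)
  · exact hasDerivAt_of_tendstoLocallyUniformly_exp_yosida hB hinj hU x t

end UnitaryGroup

/-! ### Mild solutions -/

theorem integral_integral_triangle_swap {E : Type*} [NormedAddCommGroup E] [NormedSpace ℝ E]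
    {F : ℝ → ℝ → E} {a b : ℝ} (hab : a ≤ b)
    (hF : Integrable (Function.uncurry F)
      ((volume.restrict (Ioc a b)).prod (volume.restrict (Ioc a b)))) :
    ∫ t in a..b, ∫ s in a..t, F t s = ∫ s in a..b, ∫ t in s..b, F t s := by
  rw [intervalIntegral.integral_of_le hab, intervalIntegral.integral_of_le hab]
  have lower : ∀ t ∈ Ioc a b, ∫ s in Ioc a b, (Iic t).indicator (F t) s = ∫ s in a..t, F t s := by
    intro t ht
    rw [setIntegral_indicator measurableSet_Iic, Ioc_inter_Iic, min_eq_right ht.2,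
      intervalIntegral.integral_of_le ht.1.le]
  have upper : ∀ s ∈ Ioc a b,
      ∫ t in Ioc a b, (Ici s).indicator (F · s) t = ∫ t in s..b, F t s := by
    intro s hs
    have hset : Ioc a b ∩ Ici s = Icc s b := by
      ext t
      exact ⟨fun h => ⟨h.2, h.1.2⟩, fun h => ⟨⟨hs.1.trans_le h.1, h.2⟩, h.1⟩⟩
    rw [setIntegral_indicator measurableSet_Ici, hset, integral_Icc_eq_integral_Ioc,
      intervalIntegral.integral_of_le hs.2]
  rw [← setIntegral_congr_fun measurableSet_Ioc lower,
    ← setIntegral_congr_fun measurableSet_Ioc upper]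
  have hΔ : MeasurableSet {p : ℝ × ℝ | p.2 ≤ p.1} := measurableSet_le measurable_snd measurable_fst
  exact integral_integral_swap (hF.indicator hΔ)

theorem integral_bilin_primitive_swap {E F G : Type*} [NormedAddCommGroup E] [NormedSpace ℝ E]
    [CompleteSpace E] [NormedAddCommGroup F] [NormedSpace ℝ F] [CompleteSpace F]
    [NormedAddCommGroup G] [NormedSpace ℝ G] [CompleteSpace G] (L : E →L[ℝ] F →L[ℝ] G)
    {f : ℝ → E} {g : ℝ → F} {a b : ℝ} (hab : a ≤ b) (hf : IntervalIntegrable f volume a b)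
    (hg : IntervalIntegrable g volume a b) :
    ∫ t in a..b, L (f t) (∫ s in a..t, g s) = ∫ s in a..b, L (∫ t in s..b, f t) (g s) := by
  have hsub : ∀ {s t}, s ∈ uIcc a b → t ∈ uIcc a b → uIcc s t ⊆ uIcc a b := uIcc_subset_uIcc
  have lower : ∀ t ∈ uIcc a b, ∫ s in a..t, L (f t) (g s) = L (f t) (∫ s in a..t, g s) :=
    fun t ht => (L (f t)).intervalIntegral_comp_comm (hg.mono_set (hsub left_mem_uIcc ht))
  have upper : ∀ s ∈ uIcc a b, ∫ t in s..b, L (f t) (g s) = L (∫ t in s..b, f t) (g s) :=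
    fun s hs => (L.flip (g s)).intervalIntegral_comp_comm (hf.mono_set (hsub hs right_mem_uIcc))
  rw [← intervalIntegral.integral_congr lower, ← intervalIntegral.integral_congr upper]
  rw [intervalIntegrable_iff_integrableOn_Ioc_of_le hab] at hf hg
  refine integral_integral_triangle_swap hab
    (((hf.norm.mul_prod hg.norm).const_mul ‖L‖).mono'
      (L.aestronglyMeasurable_comp₂ hf.1.comp_fst hg.1.comp_snd) (Eventually.of_forall fun p => ?_))
  rw [← mul_assoc]
  exact L.le_opNorm₂ _ _

section Mild

variable {E : Type*} [NormedAddCommGroup E] [InnerProductSpace ℝ E]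
  {B : E →L[ℝ] E} {U : ℝ → E →L[ℝ] E}

namespace IsUnitaryGroup

theorem continuous_uncurry (hU : IsUnitaryGroup B U) : Continuous fun p : ℝ × E => U p.1 p.2 :=
  continuous_prod_of_continuous_lipschitzWith' _ 1
    (fun t => (AddMonoidHomClass.isometry_of_norm (U t) (hU.norm_map t)).lipschitz) hU.continuous

theorem neg_apply_apply (hU : IsUnitaryGroup B U) (t : ℝ) (x : E) : U (-t) (U t x) = x := by
  rw [← hU.map_add, neg_add_cancel, hU.map_zero]

theorem inner_map_left (hU : IsUnitaryGroup B U) (t : ℝ) (x y : E) :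
    ⟪U t x, y⟫ = ⟪x, U (-t) y⟫ := by
  have h := LinearIsometry.inner_map_map ⟨(U (-t) : E →ₗ[ℝ] E), hU.norm_map (-t)⟩ (U t x) y
  exact h.symm.trans (congrArg (⟪·, U (-t) y⟫) (hU.neg_apply_apply t x))

theorem norm_map_apply_sub_le (hU : IsUnitaryGroup B U) (x : E) (t : ℝ) :
    ‖U t (B x) - B x‖ ≤ ‖x‖ * |t| := by
  have hmv := Convex.norm_image_sub_le_of_norm_hasDerivWithin_le
      (fun s _ => (hU.hasDerivAt x s).hasDerivWithinAt)
      (fun s _ => (hU.norm_map s x).le) convex_univ (mem_univ 0) (mem_univ t)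
  simpa [hU.map_zero] using hmv

theorem integrable_map {α : Type*} [MeasurableSpace α] {μ : Measure α} (hU : IsUnitaryGroup B U)
    {τ : α → ℝ} {f : α → E} (hτ : AEStronglyMeasurable τ μ) (hf : Integrable f μ) :
    Integrable (fun p => U (τ p) (f p)) μ :=
  hf.norm.mono' (hU.continuous_uncurry.comp_aestronglyMeasurable (hτ.prodMk hf.1))
    (Eventually.of_forall fun _ => (hU.norm_map _ _).le)

theorem integral_map [CompleteSpace E] (hU : IsUnitaryGroup B U) (x : E) (a b : ℝ) :
    ∫ s in a..b, U s x = U b (B x) - U a (B x) :=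
  intervalIntegral.integral_eq_sub_of_hasDerivAt (fun s _ => hU.hasDerivAt x s)
    ((hU.continuous x).intervalIntegrable _ _)

end IsUnitaryGroup

/-- The mild solution, given by Duhamel's formula, of `Y' = B⁻¹ Y + f`, `Y 0 = c`, where `U` is
the group generated by `B⁻¹`. -/
def mild (U : ℝ → E →L[ℝ] E) (c : E) (f : ℝ → E) (t : ℝ) : E :=
  U t c + ∫ s in (0 : ℝ)..t, U (t - s) (f s)

theorem mild_zero (hU : IsUnitaryGroup B U) (c : E) (f : ℝ → E) : mild U c f 0 = c := by
  rw [mild, hU.map_zero, intervalIntegral.integral_same, add_zero]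

variable [CompleteSpace E]

theorem integral_map_sub (hU : IsUnitaryGroup B U) {f : ℝ → E} (hf : Integrable f) (r a b : ℝ) :
    ∫ s in a..b, U (r - s) (f s) = U r (∫ s in a..b, U (-s) (f s)) := by
  have hi : Integrable fun s => U (-s) (f s) :=
    hU.integrable_map continuous_neg.aestronglyMeasurable hf
  rw [← (U r).intervalIntegral_comp_comm hi.intervalIntegrable]
  simp only [sub_eq_add_neg, hU.map_add]

theorem continuous_mild (hU : IsUnitaryGroup B U) (c : E) {f : ℝ → E} (hf : Integrable f) :
    Continuous (mild U c f) := by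
  have hi : Integrable fun s => U (-s) (f s) :=
    hU.integrable_map continuous_neg.aestronglyMeasurable hf
  have h : Continuous fun t => U t (∫ s in (0 : ℝ)..t, U (-s) (f s)) :=
    hU.continuous_uncurry.comp (continuous_id.prodMk
      (intervalIntegral.continuous_primitive (fun _ _ => hi.intervalIntegrable) 0))
  exact (hU.continuous c).add (h.congr fun t => (integral_map_sub hU hf t 0 t).symm)

theorem integral_integral_map_sub (hU : IsUnitaryGroup B U) {f : ℝ → E} (hf : Integrable f)
    {t : ℝ} (ht : 0 ≤ t) :
    ∫ s in (0 : ℝ)..t, ∫ r in (0 : ℝ)..s, U (s - r) (f r)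
      = ∫ r in (0 : ℝ)..t, (U (t - r) (B (f r)) - B (f r)) := by
  have hi : Integrable (Function.uncurry fun s r => U (s - r) (f r))
      ((volume.restrict (Ioc 0 t)).prod (volume.restrict (Ioc 0 t))) :=
    hU.integrable_map (measurable_fst.sub measurable_snd).aestronglyMeasurable
      (hf.restrict.comp_snd _)
  rw [integral_integral_triangle_swap ht hi]
  refine intervalIntegral.integral_congr fun r _ => ?_
  rw [intervalIntegral.integral_comp_sub_right (fun s => U s (f r)), hU.integral_map, sub_self,
    hU.map_zero]

theorem map_mild (hU : IsUnitaryGroup B U) (c : E) {f : ℝ → E} (hf : Integrable f) {t : ℝ}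
    (ht : 0 ≤ t) :
    B (mild U c f t) = B c + ∫ s in (0 : ℝ)..t, (mild U c f s + B (f s)) := by
  have hBf : Integrable fun s => B (f s) := B.integrable_comp hf
  have hUf : Integrable fun s => U (t - s) (f s) :=
    hU.integrable_map (measurable_const.sub measurable_id).aestronglyMeasurable hf
  have hUBf : Integrable fun s => U (t - s) (B (f s)) :=
    hU.integrable_map (measurable_const.sub measurable_id).aestronglyMeasurable hBf
  have hconv : Continuous fun s => ∫ r in (0 : ℝ)..s, U (s - r) (f r) :=
    ((continuous_mild hU c hf).sub (hU.continuous c)).congr fun s => add_sub_cancel_left _ _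
  calc B (mild U c f t)
      = U t (B c) + ∫ s in (0 : ℝ)..t, U (t - s) (B (f s)) := by
        rw [mild, map_add, ← hU.comm, ← B.intervalIntegral_comp_comm hUf.intervalIntegrable]
        simp only [hU.comm]
    _ = B c + (((∫ s in (0 : ℝ)..t, U s c)
          + ∫ s in (0 : ℝ)..t, ∫ r in (0 : ℝ)..s, U (s - r) (f r))
          + ∫ s in (0 : ℝ)..t, B (f s)) := by
        rw [integral_integral_map_sub hU hf ht, hU.integral_map, hU.map_zero,
          intervalIntegral.integral_sub hUBf.intervalIntegrable hBf.intervalIntegrable]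
        abel
    _ = B c + ∫ s in (0 : ℝ)..t, (mild U c f s + B (f s)) := by
        rw [intervalIntegral.integral_add
            ((continuous_mild hU c hf).intervalIntegrable _ _) hBf.intervalIntegrable,
          ← intervalIntegral.integral_add ((hU.continuous c).intervalIntegrable _ _)
            (hconv.intervalIntegrable _ _)]
        rfl

/-- The energy `‖B D‖²` is conserved. -/
theorem eq_zero_of_hasDerivWithinAt (hB : B ∈ skewAdjoint (E →L[ℝ] E))
    (hinj : Function.Injective B) {a b : ℝ} {D : ℝ → E}
    (hD : ∀ t ∈ Icc a b, HasDerivWithinAt (fun s => B (D s)) (D t) (Icc a b) t)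
    (hb : D b = 0) {t : ℝ} (ht : t ∈ Icc a b) : D t = 0 := by
  have henergy : ∀ s ∈ Icc a b, HasDerivWithinAt (fun s => ‖B (D s)‖ ^ 2) 0 (Icc a b) s := by
    intro s hs
    refine (hD s hs).norm_sq.congr_deriv ?_
    linarith [inner_apply_left_of_mem_skewAdjoint hB (D s) (D s), real_inner_comm (D s) (B (D s))]
  have hmv := Convex.norm_image_sub_le_of_norm_hasDerivWithin_le (C := 0) henergy
    (fun s _ => by rw [norm_zero]) (convex_Icc a b) (right_mem_Icc.mpr (ht.1.trans ht.2)) ht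
  rw [hb, map_zero, norm_zero, zero_mul, norm_le_zero_iff, zero_pow two_ne_zero, sub_zero,
    sq_eq_zero_iff, norm_eq_zero] at hmv
  exact hinj (by rw [hmv, map_zero])

/-- The mild solution of `Y' = B⁻¹ Y + f`, `Y T = 0`. -/
def backward (U : ℝ → E →L[ℝ] E) (T : ℝ) (f : ℝ → E) : ℝ → E :=
  mild U (-∫ s in (0 : ℝ)..T, U (-s) (f s)) f

theorem continuous_backward (hU : IsUnitaryGroup B U) (T : ℝ) {f : ℝ → E} (hf : Integrable f) :
    Continuous (backward U T f) :=
  continuous_mild hU _ hf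

theorem backward_eq_neg_integral (hU : IsUnitaryGroup B U) {f : ℝ → E} (hf : Integrable f)
    (T t : ℝ) : backward U T f t = -U t (∫ s in t..T, U (-s) (f s)) := by
  have hi : Integrable fun s => U (-s) (f s) :=
    hU.integrable_map continuous_neg.aestronglyMeasurable hf
  rw [backward, mild, integral_map_sub hU hf, ← map_add, ← map_neg (U t),
    ← intervalIntegral.integral_add_adjacent_intervals (b := t) hi.intervalIntegrable
      hi.intervalIntegrable]
  congr 1
  abel

theorem backward_final (hU : IsUnitaryGroup B U) {f : ℝ → E} (hf : Integrable f) (T : ℝ) :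
    backward U T f T = 0 := by
  rw [backward_eq_neg_integral hU hf, intervalIntegral.integral_same, map_zero, neg_zero]

theorem integral_inner_map (hU : IsUnitaryGroup B U) {f : ℝ → E} (hf : Integrable f) (T : ℝ)
    (x : E) : ∫ t in (0 : ℝ)..T, ⟪f t, U t x⟫ = -⟪x, backward U T f 0⟫ := by
  have hi : Integrable fun s => U (-s) (f s) :=
    hU.integrable_map continuous_neg.aestronglyMeasurable hf
  rw [backward_eq_neg_integral hU hf, hU.map_zero, inner_neg_right, neg_neg]
  refine Eq.trans (intervalIntegral.integral_congr fun t _ => ?_)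
    ((innerSL ℝ x).intervalIntegral_comp_comm hi.intervalIntegrable)
  exact (real_inner_comm _ _).trans (hU.inner_map_left t x (f t))

theorem integral_inner_map_backward (hB : B ∈ skewAdjoint (E →L[ℝ] E)) (hU : IsUnitaryGroup B U)
    {T : ℝ} (hT : 0 ≤ T) {f g : ℝ → E} (hf : Integrable f) (hg : Integrable g) :
    ∫ t in (0 : ℝ)..T, ⟪g t, B (backward U T f t)⟫
      = ∫ t in (0 : ℝ)..T, ⟪f t, B (mild U 0 g t)⟫ := by
  have hf' : Integrable fun s => U (-s) (f s) :=
    hU.integrable_map continuous_neg.aestronglyMeasurable hf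
  have hg' : Integrable fun s => U (-s) (g s) :=
    hU.integrable_map continuous_neg.aestronglyMeasurable hg
  have hswap := integral_bilin_primitive_swap (innerSL ℝ) hT hf'.intervalIntegrable
    (B.integrable_comp hg').intervalIntegrable
  refine Eq.trans ?_ (hswap.symm.trans ?_) <;>
    refine intervalIntegral.integral_congr fun t _ => ?_
  · calc ⟪g t, B (backward U T f t)⟫ = ⟪U t (∫ s in t..T, U (-s) (f s)), B (g t)⟫ := by
          rw [real_inner_comm, inner_apply_left_of_mem_skewAdjoint hB,
            backward_eq_neg_integral hU hf, inner_neg_left, neg_neg]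
      _ = ⟪∫ s in t..T, U (-s) (f s), B (U (-t) (g t))⟫ := by rw [hU.inner_map_left, hU.comm]
  · calc ⟪U (-t) (f t), ∫ s in (0 : ℝ)..t, B (U (-s) (g s))⟫
        = ⟪f t, U t (B (∫ s in (0 : ℝ)..t, U (-s) (g s)))⟫ := by
          rw [hU.inner_map_left, neg_neg, ← B.intervalIntegral_comp_comm hg'.intervalIntegrable]
      _ = ⟪f t, B (mild U 0 g t)⟫ := by
          rw [hU.comm, mild, map_zero, zero_add, integral_map_sub hU hg]

end Mild

/-! ### Volterra equations with kernel `t - s` -/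

section Volterra

theorem sq_mul_integral_sub_mul_exp (κ t : ℝ) :
    κ ^ 2 * ∫ s in (0 : ℝ)..t, (t - s) * Real.exp (κ * s) = Real.exp (κ * t) - 1 - κ * t := by
  have hd : ∀ s ∈ uIcc 0 t, HasDerivAt (fun s => (κ * (t - s) + 1) * Real.exp (κ * s))
      (κ ^ 2 * ((t - s) * Real.exp (κ * s))) s := fun s _ => by
    have hlin : HasDerivAt (fun s => κ * (t - s) + 1) (κ * -1) s :=
      (((hasDerivAt_id s).const_sub t).const_mul κ).add_const 1
    have hexp : HasDerivAt (fun s => Real.exp (κ * s)) (Real.exp (κ * s) * (κ * 1)) s :=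
      ((hasDerivAt_id s).const_mul κ).exp
    exact (hlin.mul hexp).congr_deriv (by ring)
  have hc : Continuous fun s => κ ^ 2 * ((t - s) * Real.exp (κ * s)) := by fun_prop
  rw [← intervalIntegral.integral_const_mul,
    intervalIntegral.integral_eq_sub_of_hasDerivAt hd (hc.intervalIntegrable _ _), sub_self,
    mul_zero, zero_add, one_mul, Real.exp_zero, sub_zero]
  ring

variable {T M : ℝ}

-- `κ = 2√M` makes `M / κ²` equal to `1 / 4`, whatever `M` is.
theorem mul_integral_sub_mul_le_of_le_exp {y : ℝ → ℝ} (hy : Continuous y) {N : ℝ} (hM : 0 ≤ M)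
    (hN : ∀ s ∈ Icc 0 T, y s ≤ N * Real.exp (2 * √M * s)) (hN0 : 0 ≤ N) {t : ℝ}
    (ht : t ∈ Icc 0 T) :
    M * ∫ s in (0 : ℝ)..t, (t - s) * y s ≤ N / 4 * Real.exp (2 * √M * t) := by
  have hmono : ∫ s in (0 : ℝ)..t, (t - s) * y s
      ≤ ∫ s in (0 : ℝ)..t, N * ((t - s) * Real.exp (2 * √M * s)) := by
    refine intervalIntegral.integral_mono_on ht.1 (Continuous.intervalIntegrable (by fun_prop) _ _)
      (Continuous.intervalIntegrable (by fun_prop) _ _) fun s hs => ?_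
    have h0 : 0 ≤ t - s := sub_nonneg.mpr hs.2
    linarith [mul_le_mul_of_nonneg_left (hN s ⟨hs.1, hs.2.trans ht.2⟩) h0]
  have hker : M * ∫ s in (0 : ℝ)..t, (t - s) * Real.exp (2 * √M * s)
      ≤ 1 / 4 * Real.exp (2 * √M * t) := by
    have h := sq_mul_integral_sub_mul_exp (2 * √M) t
    rw [mul_pow, Real.sq_sqrt hM] at h
    have hκt : 0 ≤ 2 * √M * t := mul_nonneg (by positivity) ht.1
    linarith
  calc M * ∫ s in (0 : ℝ)..t, (t - s) * y s
      ≤ M * (N * ∫ s in (0 : ℝ)..t, (t - s) * Real.exp (2 * √M * s)) := by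
        rw [← intervalIntegral.integral_const_mul N]
        gcongr
    _ = N * (M * ∫ s in (0 : ℝ)..t, (t - s) * Real.exp (2 * √M * s)) := by ring
    _ ≤ N * (1 / 4 * Real.exp (2 * √M * t)) := by gcongr
    _ = N / 4 * Real.exp (2 * √M * t) := by ring

variable {H : Type*} [NormedAddCommGroup H]

theorem norm_le_of_norm_le_add_integral_sub_mul {u : ℝ → H} (hu : Continuous u) {a : ℝ}
    (hM : 0 ≤ M) (ha : 0 ≤ a)
    (h : ∀ t ∈ Icc 0 T, ‖u t‖ ≤ a + M * ∫ s in (0 : ℝ)..t, (t - s) * ‖u s‖) {t : ℝ}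
    (ht : t ∈ Icc 0 T) : ‖u t‖ ≤ 4 / 3 * a * Real.exp (2 * √M * t) := by
  obtain ⟨t₀, ht₀, hmax⟩ := isCompact_Icc.exists_isMaxOn ⟨t, ht⟩
    (f := fun s => ‖u s‖ / Real.exp (2 * √M * s))
    (by fun_prop (disch := exact fun _ _ => Real.exp_ne_zero _))
  set N := ‖u t₀‖ / Real.exp (2 * √M * t₀) with hN
  have hN0 : 0 ≤ N := by positivity
  have hle : ∀ s ∈ Icc 0 T, ‖u s‖ ≤ N * Real.exp (2 * √M * s) := fun s hs =>
    (div_le_iff₀ (Real.exp_pos _)).mp (hmax hs)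
  have hNa : N ≤ a + N / 4 := by
    have hexp : 1 ≤ Real.exp (2 * √M * t₀) := Real.one_le_exp (mul_nonneg (by positivity) ht₀.1)
    rw [hN, div_le_iff₀ (Real.exp_pos _), ← hN]
    calc ‖u t₀‖ ≤ a + N / 4 * Real.exp (2 * √M * t₀) := (h t₀ ht₀).trans
          (add_le_add_right (mul_integral_sub_mul_le_of_le_exp hu.norm hM hle hN0 ht₀) a)
      _ ≤ (a + N / 4) * Real.exp (2 * √M * t₀) := by
          rw [add_mul]
          gcongr
          exact le_mul_of_one_le_right ha hexp
  refine (hle t ht).trans ?_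
  gcongr
  linarith

variable [NormedSpace ℝ H]

/-- The function `s ↦ e^{κ s} v(s)`, with `v` extended from `[0,T]` by constants; `v` is its norm
in the weighted supremum norm in which Volterra operators are contractions. -/
def expWeight (hT : 0 ≤ T) (κ : ℝ) (v : C(Icc 0 T, H)) (s : ℝ) : H :=
  Real.exp (κ * s) • v (projIcc 0 T hT s)

theorem continuous_expWeight (hT : 0 ≤ T) (κ : ℝ) (v : C(Icc 0 T, H)) :
    Continuous (expWeight hT κ v) :=
  (Real.continuous_exp.comp (continuous_const.mul continuous_id)).smul
    (v.continuous.comp continuous_projIcc)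

theorem norm_expWeight_sub_expWeight_le (hT : 0 ≤ T) (κ : ℝ) (v w : C(Icc 0 T, H)) (s : ℝ) :
    ‖expWeight hT κ v s - expWeight hT κ w s‖ ≤ dist v w * Real.exp (κ * s) := by
  rw [expWeight, expWeight, ← smul_sub, norm_smul, Real.norm_of_nonneg (Real.exp_nonneg _),
    mul_comm, ← dist_eq_norm]
  gcongr
  exact ContinuousMap.dist_apply_le_dist _

theorem exists_eq_sub_of_norm_sub_le_integral_sub_mul [CompleteSpace H] (hT : 0 ≤ T) (hM : 0 ≤ M)
    {K : (ℝ → H) → ℝ → H} (hKc : ∀ f, Continuous f → Continuous (K f))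
    (hK : ∀ f g, Continuous f → Continuous g → ∀ t ∈ Icc 0 T,
      ‖K f t - K g t‖ ≤ M * ∫ s in (0 : ℝ)..t, (t - s) * ‖f s - g s‖)
    {h : ℝ → H} (hh : Continuous h) :
    ∃ u : ℝ → H, Continuous u ∧ ∀ t ∈ Icc 0 T, u t = h t - K u t := by
  set κ := 2 * √M
  let e : C(Icc 0 T, H) → ℝ → H := expWeight hT κ
  have he : ∀ v, Continuous (e v) := continuous_expWeight hT κ
  let Φ : C(Icc 0 T, H) → C(Icc 0 T, H) := fun v =>
    ⟨fun t => Real.exp (-(κ * t)) • (h t - K (e v) t), by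
      have := hKc _ (he v)
      fun_prop⟩
  have hΦ : ContractingWith (1 / 4) Φ := by
    refine ⟨by rw [← NNReal.coe_lt_coe]; norm_num, LipschitzWith.of_dist_le_mul fun v w => ?_⟩
    refine (ContinuousMap.dist_le (by positivity)).mpr fun t => ?_
    have hle := (hK _ _ (he w) (he v) t t.2).trans
      (mul_integral_sub_mul_le_of_le_exp ((he w).sub (he v)).norm hM
        (fun s _ => norm_expWeight_sub_expWeight_le hT κ w v s) dist_nonneg t.2)
    calc dist (Φ v t) (Φ w t)
        = Real.exp (-(κ * t)) * ‖K (e w) t - K (e v) t‖ := by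
          rw [dist_eq_norm, ← Real.norm_of_nonneg (Real.exp_nonneg (-(κ * t))), ← norm_smul,
            ← sub_sub_sub_cancel_left (K (e v) t) (K (e w) t) (h t), smul_sub]
          rfl
      _ ≤ Real.exp (-(κ * t)) * (dist w v / 4 * Real.exp (κ * t)) := by gcongr
      _ = (1 / 4 : NNReal) * dist v w := by
          rw [mul_comm, mul_assoc, ← Real.exp_add, add_neg_cancel, Real.exp_zero, dist_comm]
          push_cast
          ring
  refine ⟨e (hΦ.fixedPoint Φ), he _, fun t ht => ?_⟩
  have hfix : Real.exp (-(κ * t)) • (h t - K (e (hΦ.fixedPoint Φ)) t) = hΦ.fixedPoint Φ ⟨t, ht⟩ :=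
    congrArg (fun w : C(Icc 0 T, H) => w ⟨t, ht⟩) hΦ.fixedPoint_isFixedPt
  simp only [e, expWeight] at hfix ⊢
  rw [projIcc_of_mem hT ht, ← hfix, smul_smul, ← Real.exp_add, add_neg_cancel, Real.exp_zero,
    one_smul]

end Volterra

/-! ### Weak derivatives on an interval -/

theorem integrableOn_Ioo_of_continuousOn {X : Type*} [NormedAddCommGroup X] {a b : ℝ} {u : ℝ → X}
    (hu : ContinuousOn u (Icc a b)) : IntegrableOn u (Ioo a b) :=
  hu.integrableOn_Icc.mono_set Ioo_subset_Icc_self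

theorem memLp_of_continuousOn {X : Type*} [NormedAddCommGroup X] {a b : ℝ} {p : ℝ≥0∞} {u : ℝ → X}
    (hu : ContinuousOn u (Icc a b)) : MemLp u p (volume.restrict (Ioo a b)) := by
  obtain ⟨C, hC⟩ := isCompact_Icc.exists_bound_of_continuousOn hu
  refine MemLp.of_bound ((hu.mono Ioo_subset_Icc_self).aestronglyMeasurable measurableSet_Ioo) C ?_
  filter_upwards [ae_restrict_mem measurableSet_Ioo] with t ht
  exact hC t (Ioo_subset_Icc_self ht)

section WeakDeriv

variable {X Y : Type*} [NormedAddCommGroup X] [NormedSpace ℝ X] [NormedAddCommGroup Y]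
  [NormedSpace ℝ Y] {a b : ℝ} {η : ℝ → ℝ} {u v u' v' : ℝ → X}

theorem intervalIntegral_eq_integral_Ioo (hab : a ≤ b) (f : ℝ → X) :
    ∫ s in a..b, f s = ∫ s in Ioo a b, f s := by
  rw [intervalIntegral.integral_of_le hab, integral_Ioc_eq_integral_Ioo]

namespace IsTestFunction

theorem apply_left (hη : IsTestFunction a b η) : η a = 0 :=
  image_eq_zero_of_notMem_tsupport fun h => lt_irrefl a (hη.2.2 h).1

theorem apply_right (hη : IsTestFunction a b η) : η b = 0 :=
  image_eq_zero_of_notMem_tsupport fun h => lt_irrefl b (hη.2.2 h).2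

theorem continuous_deriv (hη : IsTestFunction a b η) : Continuous (deriv η) :=
  (contDiff_infty_iff_deriv.mp hη.1).2.continuous

theorem integral_deriv (hη : IsTestFunction a b η) (s t : ℝ) :
    ∫ x in s..t, deriv η x = η t - η s :=
  intervalIntegral.integral_deriv_eq_sub
    (fun _ _ => (contDiff_infty_iff_deriv.mp hη.1).1.differentiableAt)
    (hη.continuous_deriv.intervalIntegrable _ _)

theorem integrableOn_smul (hη : IsTestFunction a b η) (hu : IntegrableOn u (Ioo a b)) :
    IntegrableOn (fun s => η s • u s) (Ioo a b) := by
  obtain ⟨C, hC⟩ := hη.2.1.exists_bound_of_continuous hη.1.continuous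
  exact hu.bdd_smul C hη.1.continuous.aestronglyMeasurable (Eventually.of_forall hC)

theorem integrableOn_deriv_smul (hη : IsTestFunction a b η) (hu : IntegrableOn u (Ioo a b)) :
    IntegrableOn (fun s => deriv η s • u s) (Ioo a b) := by
  obtain ⟨C, hC⟩ := hη.2.1.deriv.exists_bound_of_continuous hη.continuous_deriv
  exact hu.bdd_smul C hη.continuous_deriv.aestronglyMeasurable (Eventually.of_forall hC)

theorem comp_mul_sub {l : ℝ} (hl : 0 < l) (hη : IsTestFunction 0 1 η) :
    IsTestFunction a (a + l) (fun s => η (l⁻¹ * (s - a))) := by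
  have hsupp : tsupport (fun s => η (l⁻¹ * (s - a))) ⊆ (fun s => l⁻¹ * (s - a)) ⁻¹' tsupport η :=
    tsupport_comp_subset_preimage η (by fun_prop)
  refine ⟨hη.1.comp (by fun_prop), hη.2.1.comp_homeomorph
    ((Homeomorph.subRight a).trans (Homeomorph.mulLeft₀ l⁻¹ (inv_ne_zero hl.ne'))), fun s hs => ?_⟩
  obtain ⟨hs0, hs1⟩ := hη.2.2 (hsupp hs)
  have hs0' : 0 < s - a := (mul_pos_iff_of_pos_left (inv_pos.mpr hl)).mp hs0
  have hs1' : s - a < l := by rwa [inv_mul_lt_iff₀ hl, mul_one] at hs1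
  exact ⟨sub_pos.mp hs0', sub_lt_iff_lt_add'.mp hs1'⟩

end IsTestFunction

theorem HasWeakDeriv.sub (hu : IntegrableOn u (Ioo a b)) (hv : IntegrableOn v (Ioo a b))
    (hu' : IntegrableOn u' (Ioo a b)) (hv' : IntegrableOn v' (Ioo a b))
    (h : HasWeakDeriv a b u v) (h' : HasWeakDeriv a b u' v') :
    HasWeakDeriv a b (fun s => u s - u' s) (fun s => v s - v' s) := by
  intro η hη
  simp only [smul_sub]
  rw [integral_sub (hη.integrableOn_deriv_smul hu) (hη.integrableOn_deriv_smul hu'),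
    integral_sub (hη.integrableOn_smul hv) (hη.integrableOn_smul hv'), h η hη, h' η hη]
  abel

theorem HasWeakDeriv.congr (h : HasWeakDeriv a b u v) (hu : ∀ t ∈ Ioo a b, u' t = u t)
    (hv : ∀ t ∈ Ioo a b, v' t = v t) : HasWeakDeriv a b u' v' := by
  intro η hη
  rw [setIntegral_congr_fun measurableSet_Ioo fun t ht => congrArg (deriv η t • ·) (hu t ht),
    setIntegral_congr_fun measurableSet_Ioo fun t ht => congrArg (η t • ·) (hv t ht)]
  exact h η hη

theorem HasWeakDeriv.clm_comp [CompleteSpace X] [CompleteSpace Y] (L : X →L[ℝ] Y)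
    (hu : IntegrableOn u (Ioo a b)) (hv : IntegrableOn v (Ioo a b)) (h : HasWeakDeriv a b u v) :
    HasWeakDeriv a b (fun s => L (u s)) (fun s => L (v s)) := by
  intro η hη
  have hL := congrArg L (h η hη)
  rw [map_neg, ← L.integral_comp_comm (hη.integrableOn_deriv_smul hu),
    ← L.integral_comp_comm (hη.integrableOn_smul hv)] at hL
  simpa only [map_smul] using hL

theorem HasWeakDeriv.prodMk [CompleteSpace X] [CompleteSpace Y] {w w' : ℝ → Y}
    (hu : IntegrableOn u (Ioo a b)) (hv : IntegrableOn v (Ioo a b))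
    (hw : IntegrableOn w (Ioo a b)) (hw' : IntegrableOn w' (Ioo a b))
    (h : HasWeakDeriv a b u v) (h' : HasWeakDeriv a b w w') :
    HasWeakDeriv a b (fun t => (u t, w t)) (fun t => (v t, w' t)) := by
  intro η hη
  simp only [Prod.smul_mk]
  rw [integral_pair (hη.integrableOn_deriv_smul hu) (hη.integrableOn_deriv_smul hw),
    integral_pair (hη.integrableOn_smul hv) (hη.integrableOn_smul hw'), h η hη, h' η hη,
    Prod.neg_mk]

theorem HasWeakDeriv.comp_add_mul {l : ℝ} (hl : 0 < l) (h : HasWeakDeriv a (a + l) u v) :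
    HasWeakDeriv 0 1 (fun x => u (a + l * x)) (fun x => l • v (a + l * x)) := by
  intro η hη
  have hderiv : deriv (fun s => η (l⁻¹ * (s - a))) = fun s => l⁻¹ * deriv η (l⁻¹ * (s - a)) := by
    ext s
    rw [deriv_comp_sub_const (fun y => η (l⁻¹ * y)), deriv_comp_mul_left, smul_eq_mul]
  have hscale : ∀ (ψ : ℝ → ℝ) (w : ℝ → X), l⁻¹ • ∫ s in a..a + l, ψ (l⁻¹ * (s - a)) • w s
      = ∫ x in (0 : ℝ)..1, ψ x • w (a + l * x) := by
    intro ψ w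
    have hcv := intervalIntegral.integral_comp_add_mul (a := 0) (b := 1)
      (fun s => ψ (l⁻¹ * (s - a)) • w s) hl.ne' a
    simpa only [mul_zero, add_zero, mul_one, add_sub_cancel_left, inv_mul_cancel_left₀ hl.ne']
      using hcv.symm
  have hw := h _ (hη.comp_mul_sub hl)
  rw [hderiv, ← intervalIntegral_eq_integral_Ioo (by linarith),
    ← intervalIntegral_eq_integral_Ioo (by linarith)] at hw
  simp only [mul_smul] at hw
  rw [intervalIntegral.integral_smul, hscale] at hw
  rw [← intervalIntegral_eq_integral_Ioo zero_le_one,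
    ← intervalIntegral_eq_integral_Ioo zero_le_one, hw]
  simp only [smul_comm _ l]
  rw [intervalIntegral.integral_smul, ← hscale, smul_inv_smul₀ hl.ne']

theorem HasWeakDeriv.eq_left_of_zero {f : ℝ → ℝ} (hf : ContinuousOn f (Icc a b))
    (h : HasWeakDeriv a b f 0) {t : ℝ} (ht : t ∈ Icc a b) : f t = f a := by
  rcases (ht.1.trans ht.2).eq_or_lt with rfl | hab
  · rw [le_antisymm ht.2 ht.1]
  obtain ⟨l, hl, rfl⟩ : ∃ l, 0 < l ∧ a + l = b := ⟨b - a, sub_pos.mpr hab, add_sub_cancel a b⟩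
  have hmaps : MapsTo (fun x => a + l * x) (Icc 0 1) (Icc a (a + l)) := fun x hx =>
    ⟨by nlinarith [hx.1], by nlinarith [hx.2]⟩
  have hg : ContinuousOn (fun x => f (a + l * x)) (Icc 0 1) := hf.comp (by fun_prop) hmaps
  obtain ⟨k, hk⟩ := ae_eq_const_of_weakDeriv_zero (integrableOn_Ioo_of_continuousOn hg)
    fun η hη => by simpa using h.comp_add_mul hl η hη
  have hconst : EqOn (fun x => f (a + l * x)) (fun _ => k) (Icc 0 1) :=
    (Measure.eqOn_open_of_ae_eq hk isOpen_Ioo (hg.mono Ioo_subset_Icc_self)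
      continuousOn_const).of_subset_closure hg continuousOn_const Ioo_subset_Icc_self
      (by rw [closure_Ioo (by norm_num)])
  have h0 := hconst (left_mem_Icc.mpr zero_le_one)
  have ht' := hconst (x := l⁻¹ * (t - a)) ⟨mul_nonneg (by positivity) (sub_nonneg.mpr ht.1), by
    rw [inv_mul_le_iff₀ hl]
    linarith [ht.2]⟩
  simp only [mul_zero, add_zero, mul_inv_cancel_left₀ hl.ne', add_sub_cancel] at h0 ht'
  rw [h0, ht']

variable [CompleteSpace X]

theorem hasWeakDeriv_of_eq_add_integral (hab : a ≤ b) (c : X) (hv : IntegrableOn v (Ioo a b))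
    (hu : ∀ t ∈ Icc a b, u t = c + ∫ s in a..t, v s) : HasWeakDeriv a b u v := by
  intro η hη
  have hvi : IntervalIntegrable v volume a b :=
    (intervalIntegrable_iff_integrableOn_Ioo_of_le hab).mpr hv
  rw [← intervalIntegral_eq_integral_Ioo hab, ← intervalIntegral_eq_integral_Ioo hab]
  have hprim : ContinuousOn (fun t => ∫ s in a..t, v s) (uIcc a b) :=
    intervalIntegral.continuousOn_primitive_interval' hvi left_mem_uIcc
  have hsplit : ∫ t in a..b, deriv η t • u t
      = (∫ t in a..b, deriv η t • c) + ∫ t in a..b, deriv η t • ∫ s in a..t, v s := by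
    have hc : Continuous fun t => deriv η t • c := hη.continuous_deriv.smul continuous_const
    have hp : ContinuousOn (fun t => deriv η t • ∫ s in a..t, v s) (uIcc a b) :=
      hη.continuous_deriv.continuousOn.smul hprim
    rw [← intervalIntegral.integral_add (hc.intervalIntegrable _ _) hp.intervalIntegrable]
    refine intervalIntegral.integral_congr fun t ht => ?_
    rw [uIcc_of_le hab] at ht
    simp only [hu t ht, smul_add]
  have hswap := integral_bilin_primitive_swap
    (ContinuousLinearMap.lsmul ℝ ℝ : ℝ →L[ℝ] X →L[ℝ] X)
    hab (hη.continuous_deriv.intervalIntegrable a b) hvi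
  simp only [ContinuousLinearMap.lsmul_apply, hη.integral_deriv, hη.apply_right, zero_sub,
    neg_smul] at hswap
  rw [hsplit, hswap, intervalIntegral.integral_smul_const, hη.integral_deriv, hη.apply_left,
    hη.apply_right, sub_zero, zero_smul, zero_add, intervalIntegral.integral_neg]

theorem hasWeakDeriv_of_hasDerivWithinAt (hab : a ≤ b) (hv : ContinuousOn v (Icc a b))
    (h : ∀ t ∈ Icc a b, HasDerivWithinAt u (v t) (Icc a b) t) : HasWeakDeriv a b u v := by
  refine hasWeakDeriv_of_eq_add_integral hab (u a) (integrableOn_Ioo_of_continuousOn hv)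
    fun t ht => ?_
  have hsub : Icc a t ⊆ Icc a b := Icc_subset_Icc_right ht.2
  have hderiv : ∀ s ∈ Ioo a t, HasDerivAt u (v s) s := fun s hs =>
    (h s (hsub (Ioo_subset_Icc_self hs))).hasDerivAt
      (Icc_mem_nhds hs.1 (hs.2.trans_le ht.2))
  rw [intervalIntegral.integral_eq_sub_of_hasDerivAt_of_le ht.1
    (fun s hs => (h s (hsub hs)).continuousWithinAt.mono hsub) hderiv
    ((hv.mono hsub).intervalIntegrable_of_Icc ht.1), add_sub_cancel]

theorem HasWeakDeriv.eq_add_integral (h : HasWeakDeriv a b u v) (hu : ContinuousOn u (Icc a b))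
    (hv : IntegrableOn v (Ioo a b)) {t : ℝ} (ht : t ∈ Icc a b) :
    u t = u a + ∫ s in a..t, v s := by
  have hab : a ≤ b := ht.1.trans ht.2
  have hvi : IntervalIntegrable v volume a b :=
    (intervalIntegrable_iff_integrableOn_Ioo_of_le hab).mpr hv
  have hprim : ContinuousOn (fun t => ∫ s in a..t, v s) (Icc a b) := by
    rw [← uIcc_of_le hab]
    exact intervalIntegral.continuousOn_primitive_interval' hvi left_mem_uIcc
  have hd : ContinuousOn (fun t => u t - ∫ s in a..t, v s) (Icc a b) := hu.sub hprim
  have hw : HasWeakDeriv a b (fun t => u t - ∫ s in a..t, v s) (fun s => v s - v s) :=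
    h.sub (integrableOn_Ioo_of_continuousOn hu) hv (integrableOn_Ioo_of_continuousOn hprim) hv
      (hasWeakDeriv_of_eq_add_integral hab 0 hv fun t _ => by rw [zero_add])
  refine sub_eq_iff_eq_add.mp ((SeparatingDual.eq_iff_forall_dual_eq (R := ℝ)).mpr fun f => ?_)
  have hf : HasWeakDeriv a b (fun s => f (u s - ∫ r in a..s, v r)) 0 := by
    have h0 := hw.clm_comp f (integrableOn_Ioo_of_continuousOn hd) (hv.sub hv)
    simp only [sub_self, Pi.zero_apply, map_zero] at h0
    exact h0
  simpa using hf.eq_left_of_zero (f.continuous.comp_continuousOn hd) ht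

theorem hasDerivWithinAt_of_eq_add_integral (hv : ContinuousOn v (Icc a b))
    (hu : ∀ t ∈ Icc a b, u t = u a + ∫ s in a..t, v s) {t : ℝ} (ht : t ∈ Icc a b) :
    HasDerivWithinAt u (v t) (Icc a b) t := by
  have hint : IntervalIntegrable v volume a t :=
    (hv.mono (Icc_subset_Icc_right ht.2)).intervalIntegrable_of_Icc ht.1
  have : Fact (t ∈ Icc a b) := ⟨ht⟩
  have hd : HasDerivWithinAt (fun s => u a + ∫ r in a..s, v r) (v t) (Icc a b) t :=
    (intervalIntegral.integral_hasDerivWithinAt_right hint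
      (hv.stronglyMeasurableAtFilter_nhdsWithin measurableSet_Icc t) (hv t ht)).const_add _
  exact hd.congr hu (hu t ht)

theorem HasWeakDeriv.hasDerivWithinAt (h : HasWeakDeriv a b u v) (hu : ContinuousOn u (Icc a b))
    (hv : ContinuousOn v (Icc a b)) {t : ℝ} (ht : t ∈ Icc a b) :
    HasDerivWithinAt u (v t) (Icc a b) t :=
  hasDerivWithinAt_of_eq_add_integral hv
    (fun _ hs => h.eq_add_integral hu (integrableOn_Ioo_of_continuousOn hv) hs) ht

end WeakDeriv

/-! ### Weak derivatives of mild solutions -/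

section Mild

variable {E : Type*} [NormedAddCommGroup E] [InnerProductSpace ℝ E] [CompleteSpace E]
  {B : E →L[ℝ] E} {U : ℝ → E →L[ℝ] E} {f : ℝ → E} {T : ℝ}

theorem hasDerivWithinAt_map_mild {X : Type*} [NormedAddCommGroup X] [NormedSpace ℝ X]
    [CompleteSpace X] (hU : IsUnitaryGroup B U) (c : E) (hf : Integrable f) (L : E →L[ℝ] X)
    (hL : ∀ s, L (B (f s)) = 0) {t : ℝ} (ht : t ∈ Icc 0 T) :
    HasDerivWithinAt (fun s => L (B (mild U c f s))) (L (mild U c f t)) (Icc 0 T) t := by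
  have hc := continuous_mild hU c hf
  refine hasDerivWithinAt_of_eq_add_integral (v := fun s => L (mild U c f s))
    (L.continuous.comp hc).continuousOn (fun s hs => ?_) ht
  have hi : IntervalIntegrable (fun r => mild U c f r + B (f r)) volume 0 s :=
    (hc.intervalIntegrable _ _).add (B.integrable_comp hf).intervalIntegrable
  rw [map_mild hU c hf hs.1, mild_zero hU, map_add, ← L.intervalIntegral_comp_comm hi]
  simp only [map_add, hL, add_zero]

theorem integrableOn_mild_add (hU : IsUnitaryGroup B U) (c : E) (hf : Integrable f) :
    IntegrableOn (fun s => mild U c f s + B (f s)) (Ioo 0 T) :=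
  (integrableOn_Ioo_of_continuousOn (continuous_mild hU c hf).continuousOn).add
    (B.integrable_comp hf).integrableOn

theorem hasWeakDeriv_map_mild (hU : IsUnitaryGroup B U) (hT : 0 ≤ T) (c : E) (hf : Integrable f) :
    HasWeakDeriv 0 T (fun s => B (mild U c f s)) (fun s => mild U c f s + B (f s)) :=
  hasWeakDeriv_of_eq_add_integral hT (B c) (integrableOn_mild_add hU c hf)
    fun _ ht => map_mild hU c hf ht.1

theorem eq_mild_of_hasWeakDeriv (hB : B ∈ skewAdjoint (E →L[ℝ] E)) (hinj : Function.Injective B)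
    (hU : IsUnitaryGroup B U) (c : E) (hf : Integrable f) {Y : ℝ → E}
    (hY : ContinuousOn Y (Icc 0 T)) (hw : HasWeakDeriv 0 T (fun s => B (Y s))
      (fun s => Y s + B (f s))) (hYT : Y T = mild U c f T) {t : ℝ} (ht : t ∈ Icc 0 T) :
    Y t = mild U c f t := by
  have hm : ContinuousOn (mild U c f) (Icc 0 T) := (continuous_mild hU c hf).continuousOn
  have hD : ContinuousOn (fun s => Y s - mild U c f s) (Icc 0 T) := hY.sub hm
  have hwD : HasWeakDeriv 0 T (fun s => B (Y s - mild U c f s)) (fun s => Y s - mild U c f s) := by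
    refine (hw.sub (integrableOn_Ioo_of_continuousOn (B.continuous.comp_continuousOn hY))
      ((integrableOn_Ioo_of_continuousOn hY).add (B.integrable_comp hf).integrableOn)
      (integrableOn_Ioo_of_continuousOn (B.continuous.comp_continuousOn hm))
      (integrableOn_mild_add hU c hf)
      (hasWeakDeriv_map_mild hU (ht.1.trans ht.2) c hf)).congr (fun s _ => map_sub B _ _)
      fun s _ => (add_sub_add_right_eq_sub _ _ _).symm
  exact sub_eq_zero.mp (eq_zero_of_hasDerivWithinAt hB hinj
    (fun s hs => hwD.hasDerivWithinAt (B.continuous.comp_continuousOn hD) hD hs)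
    (sub_eq_zero.mpr hYT) ht)

end Mild

/-! ### The abstract wave equation -/

section AbstractWave

variable {H K : Type*} [NormedAddCommGroup H] [NormedAddCommGroup K] {T : ℝ}

/-- The force `f` acting on the first component, as a source term in the state space. It is
extended by zero outside `(0,T)`. -/
def source (T : ℝ) (f : ℝ → H) : ℝ → WithLp 2 (H × K) :=
  (Ioo 0 T).indicator fun t => WithLp.toLp 2 (f t, 0)

theorem source_of_mem (f : ℝ → H) {t : ℝ} (ht : t ∈ Ioo 0 T) :
    source T f t = WithLp.toLp 2 (f t, (0 : K)) :=
  indicator_of_mem ht _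

theorem snd_source (T : ℝ) (f : ℝ → H) (t : ℝ) :
    (source T f t : WithLp 2 (H × K)).snd = 0 := by
  by_cases ht : t ∈ Ioo 0 T
  · rw [source_of_mem f ht, WithLp.toLp_snd]
  · rw [source, indicator_of_notMem ht, WithLp.zero_snd]

theorem norm_source_le (T : ℝ) (f : ℝ → H) (t : ℝ) :
    ‖(source T f t : WithLp 2 (H × K))‖ ≤ ‖f t‖ :=
  (norm_indicator_le_norm_self _ t).trans (WithLp.norm_toLp_fst 2 H K (f t)).le

theorem source_sub (T : ℝ) (f g : ℝ → H) :
    (source T (fun s => f s - g s) : ℝ → WithLp 2 (H × K))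
      = fun s => source T f s - source T g s := by
  simp only [source, ← indicator_sub, ← WithLp.toLp_sub, Prod.mk_sub_mk, sub_zero]

variable [InnerProductSpace ℝ H] [InnerProductSpace ℝ K]

theorem integrable_source {f : ℝ → H} (hf : IntegrableOn f (Ioo 0 T)) :
    Integrable (source T f : ℝ → WithLp 2 (H × K)) :=
  (integrable_indicator_iff measurableSet_Ioo).mpr
    (((WithLp.prodContinuousLinearEquiv 2 ℝ H K).symm.toContinuousLinearMap.comp
      (.inl ℝ H K)).integrable_comp hf)

theorem integral_inner_source (hT : 0 ≤ T) (f : ℝ → H) (y : ℝ → WithLp 2 (H × K)) :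
    ∫ t in (0 : ℝ)..T, ⟪source T f t, y t⟫ = ∫ t in Ioo 0 T, ⟪f t, (y t).fst⟫ := by
  rw [intervalIntegral_eq_integral_Ioo hT]
  refine setIntegral_congr_fun measurableSet_Ioo fun t ht => ?_
  rw [source_of_mem f ht, WithLp.prod_inner_apply]
  simp only [inner_zero_left, add_zero]
  rfl

variable [CompleteSpace H] [CompleteSpace K]

/-- The skew-adjoint operator `(φ, r) ↦ (-J r, J† φ)`. Its inverse generates the abstract wave
equation: for `φ'' + Λ φ = 0` with `Λ = (J J†)⁻¹`, the state is `φ` together with `J† φ'`. -/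
def waveOp (J : K →L[ℝ] H) : WithLp 2 (H × K) →L[ℝ] WithLp 2 (H × K) :=
  (WithLp.prodContinuousLinearEquiv 2 ℝ H K).symm.toContinuousLinearMap.comp
    ((-(J.comp (WithLp.sndL 2 ℝ H K))).prod ((J†).comp (WithLp.fstL 2 ℝ H K)))

variable {J : K →L[ℝ] H}

@[simp] theorem fst_waveOp (x : WithLp 2 (H × K)) : (waveOp J x).fst = -J x.snd := rfl

@[simp] theorem snd_waveOp (x : WithLp 2 (H × K)) : (waveOp J x).snd = (J†) x.fst := rfl

theorem waveOp_mem_skewAdjoint (J : K →L[ℝ] H) :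
    waveOp J ∈ skewAdjoint (WithLp 2 (H × K) →L[ℝ] WithLp 2 (H × K)) := by
  rw [skewAdjoint.mem_iff, ContinuousLinearMap.star_eq_adjoint, eq_comm,
    ContinuousLinearMap.eq_adjoint_iff]
  intro x y
  simp only [_root_.neg_apply, inner_neg_left, WithLp.prod_inner_apply, WithLp.ofLp_fst,
    WithLp.ofLp_snd, fst_waveOp, snd_waveOp, inner_neg_right,
    ContinuousLinearMap.adjoint_inner_left, ContinuousLinearMap.adjoint_inner_right]
  ring

theorem injective_waveOp (hJ : Function.Injective J) (hJ' : Function.Injective (J†)) :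
    Function.Injective (waveOp J) := fun x y h => by
  have hfst : x.fst = y.fst := hJ' (congrArg WithLp.snd h)
  have hsnd : x.snd = y.snd := hJ (neg_injective (congrArg WithLp.fst h))
  exact WithLp.ofLp_injective 2 (Prod.ext hfst hsnd)

theorem fst_waveOp_source (T : ℝ) (f : ℝ → H) (t : ℝ) : (waveOp J (source T f t)).fst = 0 := by
  rw [fst_waveOp, snd_source, map_zero, neg_zero]

variable {U : ℝ → WithLp 2 (H × K) →L[ℝ] WithLp 2 (H × K)}

/-- The state `(φ, J† φ')` at time `t` of the forced wave equation `φ'' + Λ φ = G` with zero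
initial data. -/
def duhamel (J : K →L[ℝ] H) (U : ℝ → WithLp 2 (H × K) →L[ℝ] WithLp 2 (H × K)) (T : ℝ) (G : ℝ → H)
    (t : ℝ) : WithLp 2 (H × K) :=
  waveOp J (mild U 0 (source T G) t)

theorem continuous_duhamel (hU : IsUnitaryGroup (waveOp J) U) {G : ℝ → H}
    (hG : IntegrableOn G (Ioo 0 T)) : Continuous (duhamel J U T G) :=
  (waveOp J).continuous.comp (continuous_mild hU 0 (integrable_source hG))

theorem duhamel_congr_ae {F G : ℝ → H} (h : F =ᵐ[volTime T] G) :
    duhamel J U T F = duhamel J U T G := by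
  have hs : (source T F : ℝ → WithLp 2 (H × K)) =ᵐ[volume] source T G := by
    filter_upwards [(ae_restrict_iff' measurableSet_Ioo).mp h] with t ht
    by_cases hmem : t ∈ Ioo 0 T
    · rw [source_of_mem _ hmem, source_of_mem _ hmem, ht hmem]
    · simp only [source, indicator_of_notMem hmem]
  funext t
  rw [duhamel, duhamel, mild, mild, intervalIntegral.integral_congr_ae]
  filter_upwards [hs] with s hs _
  rw [hs]

theorem integrable_map_source (hU : IsUnitaryGroup (waveOp J) U) {G : ℝ → H}
    (hG : IntegrableOn G (Ioo 0 T)) (t : ℝ) : Integrable fun s => U (t - s) (source T G s) :=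
  hU.integrable_map (measurable_const.sub measurable_id).aestronglyMeasurable (integrable_source hG)

theorem duhamel_sub (hU : IsUnitaryGroup (waveOp J) U) {F G : ℝ → H}
    (hF : IntegrableOn F (Ioo 0 T)) (hG : IntegrableOn G (Ioo 0 T)) (t : ℝ) :
    duhamel J U T (fun s => F s - G s) t = duhamel J U T F t - duhamel J U T G t := by
  simp only [duhamel, mild, source_sub, map_zero, zero_add, map_sub (U _)]
  rw [intervalIntegral.integral_sub (integrable_map_source hU hF t).intervalIntegrable
    (integrable_map_source hU hG t).intervalIntegrable, map_sub]

/-- The kernel `sin((t-s)Λ^{1/2})Λ^{-1/2}` is bounded by `t-s`: `U (t - s)` moves the source, seen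
through `waveOp J`, away from a vector without first component. -/
theorem norm_fst_duhamel_le (hU : IsUnitaryGroup (waveOp J) U) {G : ℝ → H}
    (hG : IntegrableOn G (Ioo 0 T)) {t : ℝ} (ht : t ∈ Icc 0 T) :
    ‖(duhamel J U T G t).fst‖ ≤ ∫ s in (0 : ℝ)..t, (t - s) * ‖G s‖ := by
  have hrepr : (duhamel J U T G t).fst
      = ∫ s in (0 : ℝ)..t, (waveOp J (U (t - s) (source T G s))).fst := by
    rw [duhamel, mild, map_zero, zero_add]
    exact (((WithLp.fstL 2 ℝ H K).comp (waveOp J)).intervalIntegral_comp_comm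
      (integrable_map_source hU hG t).intervalIntegrable).symm
  have hGt : IntervalIntegrable G volume 0 t :=
    (intervalIntegrable_iff_integrableOn_Ioo_of_le ht.1).mpr
      (hG.mono_set (Ioo_subset_Ioo_right ht.2))
  rw [hrepr]
  refine intervalIntegral.norm_integral_le_of_norm_le ht.1 (Eventually.of_forall fun s hs => ?_)
    (hGt.norm.continuousOn_mul (by fun_prop))
  have hts : 0 ≤ t - s := sub_nonneg.mpr hs.2
  calc ‖(waveOp J (U (t - s) (source T G s))).fst‖
      = ‖(U (t - s) (waveOp J (source T G s)) - waveOp J (source T G s)).fst‖ := by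
        rw [WithLp.sub_fst, fst_waveOp_source, sub_zero, hU.comm]
    _ ≤ ‖(source T G s : WithLp 2 (H × K))‖ * |t - s| :=
        (WithLp.norm_fst_le H _).trans (hU.norm_map_apply_sub_le _ _)
    _ ≤ (t - s) * ‖G s‖ := by
        rw [abs_of_nonneg hts, mul_comm]
        exact mul_le_mul_of_nonneg_left (norm_source_le T G s) hts

theorem norm_snd_duhamel_le (hU : IsUnitaryGroup (waveOp J) U) {G : ℝ → H} {b : ℝ}
    (hb : ∀ s ∈ Icc 0 T, ‖G s‖ ≤ b) {t : ℝ} (ht : t ∈ Icc 0 T) :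
    ‖(duhamel J U T G t).snd‖ ≤ ‖J‖ * (b * T) := by
  have hmild : ‖mild U 0 (source T G) t‖ ≤ b * |t - 0| := by
    rw [mild, map_zero, zero_add]
    refine intervalIntegral.norm_integral_le_of_norm_le_const fun s hs => ?_
    rw [uIoc_of_le ht.1] at hs
    rw [hU.norm_map]
    exact (norm_source_le T G s).trans (hb s ⟨hs.1.le, hs.2.trans ht.2⟩)
  calc ‖(J†) (mild U 0 (source T G) t).fst‖
      ≤ ‖J†‖ * ‖(mild U 0 (source T G) t).fst‖ := (J†).le_opNorm _
    _ ≤ ‖J‖ * (b * T) := by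
        rw [LinearIsometryEquiv.norm_map]
        refine mul_le_mul_of_nonneg_left ?_ (norm_nonneg J)
        rw [sub_zero, abs_of_nonneg ht.1] at hmild
        exact (WithLp.norm_fst_le H _).trans (hmild.trans
          (mul_le_mul_of_nonneg_left ht.2 ((norm_nonneg _).trans (hb t ht))))

theorem hasDerivWithinAt_adjoint_fst_duhamel (hU : IsUnitaryGroup (waveOp J) U) {G : ℝ → H}
    (hG : IntegrableOn G (Ioo 0 T)) {t : ℝ} (ht : t ∈ Icc 0 T) :
    HasDerivWithinAt (fun s => (J†) (duhamel J U T G s).fst) (duhamel J U T G t).snd (Icc 0 T) t :=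
  hasDerivWithinAt_map_mild hU 0 (integrable_source hG) ((WithLp.sndL 2 ℝ H K).comp (waveOp J))
    (fun s => (congrArg (J†) (fst_waveOp_source T G s)).trans (map_zero _)) ht

theorem hasDerivAt_adjoint_fst_map (hU : IsUnitaryGroup (waveOp J) U) (X : WithLp 2 (H × K))
    (t : ℝ) : HasDerivAt (fun s => (J†) (U s X).fst) (U t X).snd t := by
  have h := (WithLp.sndL 2 ℝ H K).hasFDerivAt.comp_hasDerivAt t (hU.hasDerivAt X t)
  refine h.congr_of_eventuallyEq (Eventually.of_forall fun s => ?_)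
  exact congrArg WithLp.snd (hU.comm s X).symm

theorem integral_inner_fst_waveOp_backward (hU : IsUnitaryGroup (waveOp J) U) (hT : 0 ≤ T)
    {F G : ℝ → H} (hF : IntegrableOn F (Ioo 0 T)) (hG : IntegrableOn G (Ioo 0 T)) :
    ∫ t in Ioo 0 T, ⟪G t, (waveOp J (backward U T (source T F) t)).fst⟫
      = ∫ t in Ioo 0 T, ⟪F t, (duhamel J U T G t).fst⟫ := by
  rw [← integral_inner_source hT, ← integral_inner_source hT]
  exact integral_inner_map_backward (waveOp_mem_skewAdjoint J) hU hT (integrable_source hF)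
    (integrable_source hG)

theorem hasDerivWithinAt_fst_waveOp_backward (hU : IsUnitaryGroup (waveOp J) U) {F : ℝ → H}
    (hF : IntegrableOn F (Ioo 0 T)) {t : ℝ} (ht : t ∈ Icc 0 T) :
    HasDerivWithinAt (fun s => (waveOp J (backward U T (source T F) s)).fst)
      (backward U T (source T F) t).fst (Icc 0 T) t :=
  hasDerivWithinAt_map_mild hU _ (integrable_source hF) (WithLp.fstL 2 ℝ H K)
    (fun s => fst_waveOp_source T F s) ht

theorem hasWeakDeriv_adjoint_fst_backward (hU : IsUnitaryGroup (waveOp J) U) (hT : 0 ≤ T)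
    {F : ℝ → H} (hF : IntegrableOn F (Ioo 0 T)) :
    HasWeakDeriv 0 T (fun s => (J†) (backward U T (source T F) s).fst)
      (fun s => (backward U T (source T F) s).snd + (J†) (F s)) := by
  have hf : Integrable (source T F : ℝ → WithLp 2 (H × K)) := integrable_source hF
  refine (HasWeakDeriv.clm_comp (WithLp.sndL 2 ℝ H K)
    (integrableOn_Ioo_of_continuousOn ((waveOp J).continuous.comp
      (continuous_backward hU T hf)).continuousOn)
    (integrableOn_mild_add hU _ hf) (hasWeakDeriv_map_mild hU hT _ hf)).congr
    (fun _ _ => rfl) fun s hs => ?_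
  rw [source_of_mem F hs]
  rfl

theorem eq_backward_of_hasWeakDeriv (hU : IsUnitaryGroup (waveOp J) U)
    (hinj : Function.Injective (waveOp J)) {F : ℝ → H} {Y : ℝ → WithLp 2 (H × K)}
    (hF : IntegrableOn F (Ioo 0 T)) (hY : ContinuousOn Y (Icc 0 T))
    (hfst : ∀ t ∈ Icc 0 T,
      HasDerivWithinAt (fun s => (waveOp J (Y s)).fst) (Y t).fst (Icc 0 T) t)
    (hsnd : HasWeakDeriv 0 T (fun t => (J†) (Y t).fst) (fun t => (Y t).snd + (J†) (F t)))
    (hYT : Y T = 0) {t : ℝ} (ht : t ∈ Icc 0 T) : Y t = backward U T (source T F) t := by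
  have hf : Integrable (source T F : ℝ → WithLp 2 (H × K)) := integrable_source hF
  have hYf : ContinuousOn (fun s => (Y s).fst) (Icc 0 T) :=
    (WithLp.fstL 2 ℝ H K).continuous.comp_continuousOn hY
  have hYs : ContinuousOn (fun s => (Y s).snd) (Icc 0 T) :=
    (WithLp.sndL 2 ℝ H K).continuous.comp_continuousOn hY
  have hBY : ContinuousOn (fun s => waveOp J (Y s)) (Icc 0 T) :=
    (waveOp J).continuous.comp_continuousOn hY
  have hBYf := integrableOn_Ioo_of_continuousOn (u := fun s => (waveOp J (Y s)).fst)
    ((WithLp.fstL 2 ℝ H K).continuous.comp_continuousOn hBY)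
  have hBYs := integrableOn_Ioo_of_continuousOn (u := fun s => (J†) (Y s).fst)
    ((J†).continuous.comp_continuousOn hYf)
  have hrhs : IntegrableOn (fun s => (Y s).snd + (J†) (F s)) (Ioo 0 T) :=
    (integrableOn_Ioo_of_continuousOn hYs).add ((J†).integrable_comp hF)
  have hstate := HasWeakDeriv.clm_comp
    (WithLp.prodContinuousLinearEquiv 2 ℝ H K).symm.toContinuousLinearMap
    (hBYf.prodMk hBYs) ((integrableOn_Ioo_of_continuousOn hYf).prodMk hrhs)
    (.prodMk hBYf (integrableOn_Ioo_of_continuousOn hYf) hBYs hrhs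
      (hasWeakDeriv_of_hasDerivWithinAt (ht.1.trans ht.2) hYf hfst) hsnd)
  refine eq_mild_of_hasWeakDeriv (waveOp_mem_skewAdjoint J) hinj hU _ hf hY
    (hstate.congr (fun _ _ => rfl) fun s hs => ?_) (hYT.trans (backward_final hU hf T).symm) ht
  rw [source_of_mem F hs]
  refine WithLp.ofLp_injective 2 (Prod.ext ?_ rfl)
  exact (congrArg _ (neg_eq_zero.mpr (map_zero J))).trans (add_zero _)

end AbstractWave

/-! ### The abstract wave equation with a potential -/

section Potential

variable {H K : Type*} [NormedAddCommGroup H] [InnerProductSpace ℝ H] [NormedAddCommGroup K]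
  [InnerProductSpace ℝ K]

theorem integrable_inner_of_memLp {α : Type*} [MeasurableSpace α] {μ : Measure α} {f g : α → H}
    (hf : MemLp f 2 μ) (hg : MemLp g 2 μ) : Integrable (fun t => ⟪f t, g t⟫) μ :=
  (hf.norm.integrable_mul hg.norm).mono' (hf.1.inner hg.1)
    (Eventually.of_forall fun _ => norm_inner_le_norm _ _)

/-- A strongly measurable family of symmetric operators, bounded by `M`: the abstract form of the
multiplication by a bounded potential depending on time. -/
structure IsPotential (m : ℝ → H →L[ℝ] H) (M : ℝ) : Prop where
  nonneg : 0 ≤ M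
  inner_map_left : ∀ t x y, ⟪m t x, y⟫ = ⟪x, m t y⟫
  norm_map_le : ∀ t x, ‖m t x‖ ≤ M * ‖x‖
  stronglyMeasurable : ∀ x, StronglyMeasurable fun t => m t x

theorem self_le_two_mul_exp_sqrt {M : ℝ} (hM : 0 ≤ M) : M ≤ 2 * Real.exp √M := by
  have hquad := Real.quadratic_le_exp_of_nonneg (Real.sqrt_nonneg M)
  rw [Real.sq_sqrt hM] at hquad
  linarith [Real.sqrt_nonneg M]

variable [CompleteSpace H] [CompleteSpace K] [SecondCountableTopology H] {J : K →L[ℝ] H}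
  {U : ℝ → WithLp 2 (H × K) →L[ℝ] WithLp 2 (H × K)} {T M : ℝ} {m : ℝ → H →L[ℝ] H}

namespace IsPotential

omit [CompleteSpace H] in
theorem memLp (hm : IsPotential m M) {μ : Measure ℝ} {u : ℝ → H} (hu : MemLp u 2 μ) :
    MemLp (fun t => m t (u t)) 2 μ := by
  borelize H
  have hjoint : StronglyMeasurable (Function.uncurry fun (x : H) (t : ℝ) => m t x) :=
    stronglyMeasurable_uncurry_of_continuous_of_stronglyMeasurable
      (fun t => (m t).continuous) hm.stronglyMeasurable
  have hmu : AEStronglyMeasurable (fun t => m t (u t)) μ :=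
    (hjoint.comp_measurable measurable_id).aestronglyMeasurable.comp_aemeasurable
      (hu.1.aemeasurable.prodMk aemeasurable_id)
  exact hu.of_le_mul hmu (Eventually.of_forall fun t => hm.norm_map_le t (u t))

omit [CompleteSpace H] in
theorem integrableOn (hm : IsPotential m M) {u : ℝ → H} (hu : Continuous u) :
    IntegrableOn (fun s => m s (u s)) (Ioo 0 T) :=
  (hm.memLp (memLp_of_continuousOn hu.continuousOn)).integrable one_le_two

theorem norm_fst_duhamel_le (hm : IsPotential m M) (hU : IsUnitaryGroup (waveOp J) U)
    {u : ℝ → H} (hu : Continuous u) {t : ℝ} (ht : t ∈ Icc 0 T) :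
    ‖(duhamel J U T (fun s => m s (u s)) t).fst‖ ≤ M * ∫ s in (0 : ℝ)..t, (t - s) * ‖u s‖ := by
  have hmu : IntervalIntegrable (fun s => m s (u s)) volume 0 t :=
    (intervalIntegrable_iff_integrableOn_Ioo_of_le ht.1).mpr (hm.integrableOn hu)
  refine (WaveTransposition.norm_fst_duhamel_le hU (hm.integrableOn hu) ht).trans ?_
  rw [← intervalIntegral.integral_const_mul]
  refine intervalIntegral.integral_mono_on ht.1 (hmu.norm.continuousOn_mul (by fun_prop))
    (Continuous.intervalIntegrable (by fun_prop) _ _) fun s hs => ?_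
  rw [mul_left_comm]
  exact mul_le_mul_of_nonneg_left (hm.norm_map_le s (u s)) (sub_nonneg.mpr hs.2)

/-- In terms of the first component alone, this is a Volterra equation with kernel `t - s`. -/
theorem exists_eq_map_sub_duhamel (hm : IsPotential m M) (hU : IsUnitaryGroup (waveOp J) U)
    (hT : 0 ≤ T) (X : WithLp 2 (H × K)) :
    ∃ Y : ℝ → WithLp 2 (H × K), Continuous Y ∧
      ∀ t ∈ Icc 0 T, Y t = U t X - duhamel J U T (fun s => m s (Y s).fst) t := by
  obtain ⟨u, huc, hu⟩ := exists_eq_sub_of_norm_sub_le_integral_sub_mul hT hm.nonneg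
    (K := fun u t => (duhamel J U T (fun s => m s (u s)) t).fst)
    (fun f hf => (WithLp.fstL 2 ℝ H K).continuous.comp
      (continuous_duhamel hU (hm.integrableOn hf)))
    (fun f g hf hg t ht => by
      rw [← WithLp.sub_fst, ← duhamel_sub hU (hm.integrableOn hf) (hm.integrableOn hg)]
      simp only [← map_sub]
      exact hm.norm_fst_duhamel_le hU (hf.sub hg) ht)
    ((WithLp.fstL 2 ℝ H K).continuous.comp (hU.continuous X))
  refine ⟨fun t => U t X - duhamel J U T (fun s => m s (u s)) t,
    (hU.continuous X).sub (continuous_duhamel hU (hm.integrableOn huc)), fun t _ => ?_⟩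
  have hfst : (fun s => m s (u s)) =ᵐ[volTime T]
      fun s => m s (U s X - duhamel J U T (fun r => m r (u r)) s).fst := by
    filter_upwards [ae_restrict_mem measurableSet_Ioo] with s hs
    exact congrArg (m s) (hu s (Ioo_subset_Icc_self hs))
  rw [← duhamel_congr_ae hfst]

section Solution

variable {X : WithLp 2 (H × K)} {Y : ℝ → WithLp 2 (H × K)}

theorem norm_fst_le (hm : IsPotential m M) (hU : IsUnitaryGroup (waveOp J) U)
    (hYc : Continuous Y)
    (hY : ∀ t ∈ Icc 0 T, Y t = U t X - duhamel J U T (fun s => m s (Y s).fst) t) {t : ℝ}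
    (ht : t ∈ Icc 0 T) : ‖(Y t).fst‖ ≤ 4 / 3 * ‖X‖ * Real.exp (2 * √M * t) := by
  have huc : Continuous fun s => (Y s).fst := (WithLp.fstL 2 ℝ H K).continuous.comp hYc
  refine norm_le_of_norm_le_add_integral_sub_mul huc hm.nonneg (norm_nonneg X) (fun s hs => ?_) ht
  rw [hY s hs]
  refine (norm_sub_le _ _).trans (add_le_add ?_ (hm.norm_fst_duhamel_le hU huc hs))
  exact (WithLp.norm_fst_le H _).trans (hU.norm_map s X).le

theorem norm_snd_le (hm : IsPotential m M) (hU : IsUnitaryGroup (waveOp J) U)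
    (hYc : Continuous Y)
    (hY : ∀ t ∈ Icc 0 T, Y t = U t X - duhamel J U T (fun s => m s (Y s).fst) t) {t : ℝ}
    (ht : t ∈ Icc 0 T) :
    ‖(Y t).snd‖ ≤ ‖X‖ + ‖J‖ * (M * (4 / 3 * ‖X‖ * Real.exp (2 * √M * T)) * T) := by
  have hforce : ∀ s ∈ Icc 0 T,
      ‖m s (Y s).fst‖ ≤ M * (4 / 3 * ‖X‖ * Real.exp (2 * √M * T)) := fun s hs => by
    refine (hm.norm_map_le s _).trans (mul_le_mul_of_nonneg_left ?_ hm.nonneg)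
    refine (hm.norm_fst_le hU hYc hY hs).trans ?_
    gcongr
    exact hs.2
  rw [hY t ht]
  refine (norm_sub_le _ _).trans (add_le_add ?_ (norm_snd_duhamel_le hU hforce ht))
  exact (WithLp.norm_snd_le H _).trans (hU.norm_map t X).le

/-- The factor `M` in the bound of the second component is absorbed by `exp √M`. -/
theorem norm_fst_add_norm_snd_le (hm : IsPotential m M) (hU : IsUnitaryGroup (waveOp J) U)
    (hJ : ‖J‖ ≤ 1) (hT : 0 ≤ T) (hYc : Continuous Y)
    (hY : ∀ t ∈ Icc 0 T, Y t = U t X - duhamel J U T (fun s => m s (Y s).fst) t) {t : ℝ}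
    (ht : t ∈ Icc 0 T) :
    ‖(Y t).fst‖ + ‖(Y t).snd‖ ≤ (3 + 3 * T) * Real.exp ((3 + 3 * T) * √M) * ‖X‖ := by
  have hM := hm.nonneg
  have hsT : 0 ≤ √M * T := mul_nonneg (Real.sqrt_nonneg M) hT
  set e := Real.exp (2 * √M * T) with he
  set Z := Real.exp ((3 + 3 * T) * √M) with hZ
  have hfst : ‖(Y t).fst‖ ≤ 4 / 3 * ‖X‖ * e := by
    refine (hm.norm_fst_le hU hYc hY ht).trans ?_
    rw [he]
    gcongr
    exact ht.2
  have hsnd : ‖(Y t).snd‖ ≤ ‖X‖ + 1 * (M * (4 / 3 * ‖X‖ * e) * T) :=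
    (hm.norm_snd_le hU hYc hY ht).trans (by gcongr)
  have hone : 1 ≤ Z := Real.one_le_exp (by positivity)
  have heZ : e ≤ Z := Real.exp_le_exp.mpr (by linarith [Real.sqrt_nonneg M])
  have hMeZ : M * e ≤ 2 * Z :=
    calc M * e ≤ 2 * Real.exp √M * e := by gcongr; exact self_le_two_mul_exp_sqrt hM
      _ = 2 * Real.exp (√M + 2 * √M * T) := by rw [he, Real.exp_add, mul_assoc]
      _ ≤ 2 * Z := by
        rw [hZ]
        gcongr
        linarith [Real.sqrt_nonneg M]
  calc ‖(Y t).fst‖ + ‖(Y t).snd‖ ≤ (4 / 3 * e + 1 + 4 / 3 * T * (M * e)) * ‖X‖ := by linarith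
    _ ≤ (4 / 3 * Z + Z + 4 / 3 * T * (2 * Z)) * ‖X‖ := by gcongr
    _ ≤ (3 + 3 * T) * Z * ‖X‖ := by
      gcongr
      nlinarith [mul_nonneg hT (zero_le_one.trans hone)]

theorem hasDerivWithinAt_adjoint_fst (hm : IsPotential m M) (hU : IsUnitaryGroup (waveOp J) U)
    (hYc : Continuous Y)
    (hY : ∀ t ∈ Icc 0 T, Y t = U t X - duhamel J U T (fun s => m s (Y s).fst) t) {t : ℝ}
    (ht : t ∈ Icc 0 T) :
    HasDerivWithinAt (fun s => (J†) (Y s).fst) (Y t).snd (Icc 0 T) t := by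
  have huc : Continuous fun s => (Y s).fst := (WithLp.fstL 2 ℝ H K).continuous.comp hYc
  have hderiv := (hasDerivAt_adjoint_fst_map hU X t).hasDerivWithinAt.sub
    (hasDerivWithinAt_adjoint_fst_duhamel hU (hm.integrableOn huc) ht)
  rw [hY t ht]
  refine hderiv.congr_of_mem (fun s hs => ?_) ht
  rw [Pi.sub_apply, ← map_sub, ← WithLp.sub_fst, ← hY s hs]

end Solution

theorem integral_inner_add_backward (hm : IsPotential m M) (hU : IsUnitaryGroup (waveOp J) U)
    (hT : 0 ≤ T) {u F : ℝ → H} (hu : MemLp u 2 (volTime T)) (hF : MemLp F 2 (volTime T)) :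
    ∫ t in Ioo 0 T, ⟪u t, F t + m t (waveOp J (backward U T (source T F) t)).fst⟫
      = ∫ t in Ioo 0 T, ⟪F t, u t + (duhamel J U T (fun s => m s (u s)) t).fst⟫ := by
  have hFi : IntegrableOn F (Ioo 0 T) := hF.integrable one_le_two
  have hmui : IntegrableOn (fun s => m s (u s)) (Ioo 0 T) := (hm.memLp hu).integrable one_le_two
  have hw : MemLp (fun t => (waveOp J (backward U T (source T F) t)).fst) 2 (volTime T) :=
    memLp_of_continuousOn ((WithLp.fstL 2 ℝ H K).continuous.comp ((waveOp J).continuous.comp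
      (continuous_backward hU T (integrable_source hFi)))).continuousOn
  have hd : MemLp (fun t => (duhamel J U T (fun s => m s (u s)) t).fst) 2 (volTime T) :=
    memLp_of_continuousOn
      ((WithLp.fstL 2 ℝ H K).continuous.comp (continuous_duhamel hU hmui)).continuousOn
  simp only [inner_add_right]
  rw [integral_add (integrable_inner_of_memLp hu hF) (integrable_inner_of_memLp hu (hm.memLp hw)),
    integral_add (integrable_inner_of_memLp hF hu) (integrable_inner_of_memLp hF hd),
    ← integral_inner_fst_waveOp_backward hU hT hFi hmui]
  simp only [hm.inner_map_left, real_inner_comm]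

theorem integral_inner_eq_neg_inner_backward (hm : IsPotential m M)
    (hU : IsUnitaryGroup (waveOp J) U) (hT : 0 ≤ T) {X : WithLp 2 (H × K)}
    {Y : ℝ → WithLp 2 (H × K)} {F : ℝ → H} (hYc : Continuous Y)
    (hY : ∀ t ∈ Icc 0 T, Y t = U t X - duhamel J U T (fun s => m s (Y s).fst) t)
    (hF : MemLp F 2 (volTime T)) :
    ∫ t in Ioo 0 T, ⟪(Y t).fst, F t + m t (waveOp J (backward U T (source T F) t)).fst⟫
      = -⟪X, backward U T (source T F) 0⟫ := by
  have hu : MemLp (fun t => (Y t).fst) 2 (volTime T) :=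
    memLp_of_continuousOn ((WithLp.fstL 2 ℝ H K).continuous.comp hYc).continuousOn
  rw [hm.integral_inner_add_backward hU hT hu hF,
    ← integral_inner_map hU (integrable_source (hF.integrable one_le_two)),
    integral_inner_source hT]
  refine setIntegral_congr_fun measurableSet_Ioo fun t ht => ?_
  have hYt := eq_sub_iff_add_eq.mp (hY t (Ioo_subset_Icc_self ht))
  rw [← WithLp.add_fst, hYt]

theorem eq_zero_of_ae_eq_neg_duhamel (hm : IsPotential m M) (hU : IsUnitaryGroup (waveOp J) U)
    {ψ : ℝ → H} (hψ : MemLp ψ 2 (volTime T))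
    (h : ∀ᵐ t ∂volTime T, ψ t = -(duhamel J U T (fun s => m s (ψ s)) t).fst) :
    ∀ᵐ t ∂volTime T, ψ t = 0 := by
  set v : ℝ → H := fun t => -(duhamel J U T (fun s => m s (ψ s)) t).fst
  have hvc : Continuous v := ((WithLp.fstL 2 ℝ H K).continuous.comp
    (continuous_duhamel hU ((hm.memLp hψ).integrable one_le_two))).neg
  have hvolterra : ∀ t, v t = -(duhamel J U T (fun s => m s (v s)) t).fst := fun t => by
    have hmv : (fun s => m s (v s)) =ᵐ[volTime T] fun s => m s (ψ s) := by
      filter_upwards [h] with s hs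
      rw [hs]
    rw [duhamel_congr_ae hmv]
  filter_upwards [h, ae_restrict_mem measurableSet_Ioo] with t ht htT
  have hbound := norm_le_of_norm_le_add_integral_sub_mul hvc hm.nonneg le_rfl (fun s hs => ?_)
    (Ioo_subset_Icc_self htT)
  · rw [mul_zero, zero_mul, norm_le_zero_iff] at hbound
    exact ht.trans hbound
  · rw [zero_add, hvolterra s, norm_neg]
    exact hm.norm_fst_duhamel_le hU hvc hs

/-- Testing with `F = ψ + D(mψ)`, where `D` is the Duhamel operator, gives `ψ = -D(mψ)`. -/
theorem ae_eq_zero_of_forall_integral_inner (hm : IsPotential m M)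
    (hU : IsUnitaryGroup (waveOp J) U) (hT : 0 ≤ T) {ψ : ℝ → H} (hψ : MemLp ψ 2 (volTime T))
    (h : ∀ F : ℝ → H, MemLp F 2 (volTime T) →
      ∫ t in Ioo 0 T, ⟪ψ t, F t + m t (waveOp J (backward U T (source T F) t)).fst⟫ = 0) :
    ∀ᵐ t ∂volTime T, ψ t = 0 := by
  have hF : MemLp (fun t => ψ t + (duhamel J U T (fun s => m s (ψ s)) t).fst) 2 (volTime T) :=
    hψ.add (memLp_of_continuousOn ((WithLp.fstL 2 ℝ H K).continuous.comp
      (continuous_duhamel hU ((hm.memLp hψ).integrable one_le_two))).continuousOn)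
  have hsq := h _ hF
  rw [hm.integral_inner_add_backward hU hT hψ hF] at hsq
  simp only [real_inner_self_eq_norm_sq] at hsq
  rw [integral_eq_zero_iff_of_nonneg (fun t => sq_nonneg _) hF.integrable_norm_pow'] at hsq
  refine hm.eq_zero_of_ae_eq_neg_duhamel hU hψ ?_
  filter_upwards [hsq] with t ht
  exact eq_neg_of_add_eq_zero_left (norm_eq_zero.mp (sq_eq_zero_iff.mp ht))

end IsPotential

end Potential

/-! ### `H¹_{(0)}(Ω)` and `H^{-1}_{(0)}(Ω)` in terms of `L²(Ω)` -/

theorem inner_Lp_eq_integral {α : Type*} [MeasurableSpace α] {μ : Measure α} (f g : Lp ℝ 2 μ) :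
    ⟪f, g⟫ = ∫ x, f x * g x ∂μ := by
  rw [L2.inner_def]
  exact integral_congr_ae (Eventually.of_forall fun x => mul_comm (g x) (f x))

theorem H10.dx_surjective : Function.Surjective H10.dx := by
  intro d
  have hd : IntegrableOn d (Ioo 0 1) := (Lp.memLp d).integrable one_le_two
  set v : ℝ → ℝ := fun x => ∫ y in (0 : ℝ)..x, d y
  have hvc : ContinuousOn v (Icc 0 1) := by
    have hprim := intervalIntegral.continuousOn_primitive_interval (μ := volume) (a := 0) (b := 1)
      (f := d) (by
        rw [uIcc_of_le zero_le_one]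
        exact (integrableOn_Icc_iff_integrableOn_Ioo).mpr hd)
    rwa [uIcc_of_le zero_le_one] at hprim
  have hvL : MemLp v 2 volΩ := memLp_of_continuousOn hvc
  have hvd : HasWeakDeriv 0 1 v d :=
    hasWeakDeriv_of_eq_add_integral zero_le_one 0 hd fun t _ => by rw [zero_add]
  refine ⟨⟨(hvL.toLp v, d), fun η hη => ?_, v, hvc, hvL.coeFn_toLp,
    intervalIntegral.integral_same⟩, rfl⟩
  rw [← hvd η hη]
  refine integral_congr_ae ?_
  filter_upwards [hvL.coeFn_toLp] with s hs
  rw [hs]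

/-- `∂ₓ : H¹_{(0)}(Ω) → L²(Ω)` as an isometric isomorphism. -/
def H10.dxEquiv : H10 ≃ₗᵢ[ℝ] L2Ω where
  toLinearEquiv := LinearEquiv.ofBijective H10.dx ⟨H10.dx_injective, H10.dx_surjective⟩
  norm_map' := fun _ => rfl

theorem H10.dxEquiv_apply (z : H10) : H10.dxEquiv z = z.dx := rfl

theorem H10.inclL2_apply (z : H10) : H10.inclL2 z = z.toL2 := rfl

/-- The operator on `L²(Ω)` taking a function to its primitive that vanishes at `0`. -/
def primitive : L2Ω →L[ℝ] L2Ω := H10.inclL2.comp (H10.dxEquiv.symm : L2Ω →L[ℝ] H10)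

theorem inclL2_dxEquiv_symm (d : L2Ω) : H10.inclL2 (H10.dxEquiv.symm d) = primitive d := rfl

theorem primitive_dx (z : H10) : primitive z.dx = H10.inclL2 z := by
  rw [← inclL2_dxEquiv_symm, ← H10.dxEquiv_apply, LinearIsometryEquiv.symm_apply_apply]

theorem norm_primitive_le : ‖primitive‖ ≤ 1 :=
  ContinuousLinearMap.opNorm_le_bound _ zero_le_one fun d => by
    rw [one_mul, ← inclL2_dxEquiv_symm, ← H10.dxEquiv.symm.norm_map d]
    exact H10.norm_toL2_le _

theorem L2Ω.eq_zero_of_forall_test {f : L2Ω}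
    (h : ∀ η, IsTestFunction 0 1 η → ∫ s in Ioo (0 : ℝ) 1, η s * f s = 0) : f = 0 := by
  have hf : IntegrableOn f (Ioo 0 1) := (Lp.memLp f).integrable one_le_two
  have hae := isOpen_Ioo.ae_eq_zero_of_integral_contDiff_smul_eq_zero (U := Ioo (0 : ℝ) 1)
    (f := f) (μ := volume) hf.locallyIntegrableOn fun ψ hψ hψc hψs => by
      rw [← h ψ ⟨hψ, hψc, hψs⟩]
      refine (setIntegral_eq_integral_of_forall_compl_eq_zero fun x hx => ?_).symm
      rw [image_eq_zero_of_notMem_tsupport fun hmem => hx (hψs hmem), zero_smul]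
  rw [Lp.eq_zero_iff_ae_eq_zero]
  exact (ae_restrict_iff' measurableSet_Ioo).mpr hae

theorem injective_primitive : Function.Injective primitive := by
  rw [injective_iff_map_eq_zero]
  intro d hd
  obtain ⟨z, rfl⟩ := H10.dx_surjective d
  rw [primitive_dx, H10.inclL2_apply] at hd
  refine L2Ω.eq_zero_of_forall_test fun η hη => ?_
  have hweak : ∫ s in Ioo (0 : ℝ) 1, deriv η s • z.toL2 s
      = -∫ s in Ioo (0 : ℝ) 1, η s • z.dx s := z.2.1 η hη
  have hzero : ∫ s in Ioo (0 : ℝ) 1, deriv η s • z.toL2 s = 0 := by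
    rw [hd]
    refine integral_eq_zero_of_ae ?_
    filter_upwards [Lp.coeFn_zero ℝ 2 volΩ] with s hs
    rw [hs]
    exact smul_zero _
  exact neg_eq_zero.mp (hweak.symm.trans hzero)

theorem IsTestFunction.exists_toL2_ae_eq {η : ℝ → ℝ} (hη : IsTestFunction 0 1 η) :
    ∃ z : H10, z.toL2 =ᵐ[volΩ] η := by
  have hd : MemLp (deriv η) 2 volΩ := memLp_of_continuousOn hη.continuous_deriv.continuousOn
  obtain ⟨z, hz⟩ := H10.dx_surjective (hd.toLp _)
  refine ⟨z, ?_⟩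
  filter_upwards [z.ae_eq_primitive, ae_restrict_mem measurableSet_Ioo] with x hx hx1
  have hprim : ∫ y in (0 : ℝ)..x, z.dx y = ∫ y in (0 : ℝ)..x, deriv η y := by
    rw [intervalIntegral_eq_integral_Ioo hx1.1.le, intervalIntegral_eq_integral_Ioo hx1.1.le, hz]
    exact integral_congr_ae
      (ae_restrict_of_ae_restrict_of_subset (Ioo_subset_Ioo_right hx1.2.le) hd.coeFn_toLp)
  rw [hx, hprim, hη.integral_deriv, hη.apply_left, sub_zero]

/-- A function orthogonal to the range of `primitive` is orthogonal to all test functions. -/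
theorem injective_adjoint_primitive : Function.Injective (primitive†) := by
  rw [injective_iff_map_eq_zero]
  intro f hf
  refine L2Ω.eq_zero_of_forall_test fun η hη => ?_
  obtain ⟨z, hz⟩ := hη.exists_toL2_ae_eq
  have horth : ⟪H10.inclL2 z, f⟫ = 0 := by
    rw [← primitive_dx, ← ContinuousLinearMap.adjoint_inner_right, hf, inner_zero_right]
  rw [inner_Lp_eq_integral] at horth
  refine Eq.trans (integral_congr_ae ?_) horth
  filter_upwards [hz] with x hx
  rw [H10.inclL2_apply, hx]

/-- The Riesz isometry `r ↦ ⟪r, ∂ₓ ·⟫` from `L²(Ω)` onto `H^{-1}_{(0)}(Ω)`. -/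
def riesz : L2Ω ≃ₗᵢ[ℝ] Hm1 :=
  LinearIsometryEquiv.ofSurjective
    { toFun := fun r => (innerSL ℝ r).comp (H10.dxEquiv : H10 →L[ℝ] L2Ω)
      map_add' := fun r s => by rw [map_add, ContinuousLinearMap.add_comp]
      map_smul' := fun c r => by
        ext z
        exact real_inner_smul_left r z.dx c
      norm_map' := fun r =>
        (ContinuousLinearMap.opNorm_comp_linearIsometryEquiv (innerSL ℝ r) H10.dxEquiv).trans
          (innerSL_apply_norm (𝕜 := ℝ) r) }
    fun φ => by
      refine ⟨(InnerProductSpace.toDual ℝ L2Ω).symm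
        (φ.comp (H10.dxEquiv.symm : L2Ω →L[ℝ] H10)), ?_⟩
      ext z
      exact (InnerProductSpace.toDual_symm_apply (𝕜 := ℝ) (E := L2Ω)).trans
        (congrArg φ (H10.dxEquiv.symm_apply_apply z))

theorem riesz_apply (r : L2Ω) (z : H10) : riesz r z = ⟪r, z.dx⟫ := rfl

theorem toHm1_eq_riesz (u : L2Ω) : u.toHm1 = riesz ((primitive†) u) := by
  ext z
  rw [riesz_apply, ContinuousLinearMap.adjoint_inner_left, primitive_dx]
  rfl

/-! ### `L²(Q_T)` as `L²(0,T; L²(Ω))` -/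

theorem measurable_of_measurable_dist {α X : Type*} [MeasurableSpace α] [PseudoMetricSpace X]
    [SecondCountableTopology X] [MeasurableSpace X] [BorelSpace X] {f : α → X}
    (h : ∀ c, Measurable fun t => dist (f t) c) : Measurable f := by
  have hbasis : TopologicalSpace.IsTopologicalBasis
      {s : Set X | ∃ c r, s = Metric.ball c r} :=
    TopologicalSpace.isTopologicalBasis_of_isOpen_of_nhds
      (by rintro _ ⟨c, r, rfl⟩; exact Metric.isOpen_ball) fun x O hx hO => by
        obtain ⟨r, hr, hrO⟩ := Metric.isOpen_iff.mp hO x hx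
        exact ⟨_, ⟨x, r, rfl⟩, Metric.mem_ball_self hr, hrO⟩
  rw [BorelSpace.measurable_eq (α := X), hbasis.borel_eq_generateFrom]
  refine measurable_generateFrom ?_
  rintro _ ⟨c, r, rfl⟩
  exact measurableSet_lt (h c) measurable_const

theorem measurable_eLpNorm_prodMk_left {α β E : Type*} [MeasurableSpace α] [MeasurableSpace β]
    [NormedAddCommGroup E] [MeasurableSpace E] [OpensMeasurableSpace E] {μ : Measure α} [SFinite μ]
    {p : ℝ≥0∞} (hp : p ≠ 0) (hp' : p ≠ ⊤) {f : α × β → E} (hf : Measurable f) :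
    Measurable fun t => eLpNorm (fun x => f (x, t)) p μ := by
  simp only [eLpNorm_eq_lintegral_rpow_enorm_toReal hp hp']
  exact ((hf.enorm.pow_const p.toReal).lintegral_prod_left').pow_const _

theorem integrable_mul_coeFn {α : Type*} [MeasurableSpace α] {μ : Measure α} (f g : Lp ℝ 2 μ) :
    Integrable (fun x => f x * g x) μ :=
  (Lp.memLp f).integrable_mul (Lp.memLp g)

theorem ae_norm_coeFn_le_norm {α E : Type*} [MeasurableSpace α] [NormedAddCommGroup E]
    {μ : Measure α} (f : Lp E ∞ μ) : ∀ᵐ x ∂μ, ‖f x‖ ≤ ‖f‖ := by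
  rw [Lp.norm_def, toReal_eLpNorm (Lp.memLp f).1]
  exact ae_le_lpNorm_exponent_top (Lp.memLp f)

section Slice

variable {α β : Type*} [MeasurableSpace α] [MeasurableSpace β] {μ : Measure α} {ν : Measure β}
  {f : α × β → ℝ} {t : β}

open Classical in
/-- The slice `f(·,t)` of a function of two variables, as an element of `L²(μ)`. The value is `0`
if this slice is not square integrable. -/
def slice (μ : Measure α) (f : α × β → ℝ) (t : β) : Lp ℝ 2 μ :=
  if h : MemLp (fun x => f (x, t)) 2 μ then h.toLp _ else 0

omit [MeasurableSpace β] in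
theorem slice_of_memLp (h : MemLp (fun x => f (x, t)) 2 μ) : slice μ f t = h.toLp _ := dif_pos h

omit [MeasurableSpace β] in
theorem coeFn_slice (h : MemLp (fun x => f (x, t)) 2 μ) : slice μ f t =ᵐ[μ] fun x => f (x, t) := by
  rw [slice_of_memLp h]
  exact h.coeFn_toLp

instance [MeasureTheory.IsSeparable μ] : SecondCountableTopology (Lp ℝ 2 μ) :=
  have : Fact ((2 : ℝ≥0∞) ≠ ⊤) := ⟨ENNReal.ofNat_ne_top⟩
  inferInstance

theorem aestronglyMeasurable_prodMk_left (hf : Measurable f) (t : β) :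
    AEStronglyMeasurable (fun x => f (x, t)) μ :=
  (hf.comp measurable_prodMk_right).aestronglyMeasurable

variable [SFinite μ]

theorem stronglyMeasurable_slice [IsSeparable μ] (hf : Measurable f) :
    StronglyMeasurable (slice μ f) := by
  classical
  borelize ↥(Lp ℝ 2 μ)
  have hnorm {g : α × β → ℝ} (hg : Measurable g) :
      Measurable fun t => eLpNorm (fun x => g (x, t)) 2 μ :=
    measurable_eLpNorm_prodMk_left two_ne_zero ENNReal.ofNat_ne_top hg
  refine Measurable.stronglyMeasurable (measurable_of_measurable_dist fun c => ?_)
  let S : Set β := {t | MemLp (fun x => f (x, t)) 2 μ}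
  have hS : MeasurableSet S := by
    have hS_eq : S = {t | eLpNorm (fun x => f (x, t)) 2 μ < ⊤} := by
      ext t
      exact and_iff_right (aestronglyMeasurable_prodMk_left hf t)
    rw [hS_eq]
    exact measurableSet_lt (hnorm hf) measurable_const
  have hdist : (fun t => dist (slice μ f t) c) = S.piecewise
      (fun t => (eLpNorm (fun x => f (x, t) - c x) 2 μ).toReal) (fun _ => dist 0 c) := by
    ext1 t
    by_cases ht : MemLp (fun x => f (x, t)) 2 μ
    · rw [piecewise_eq_of_mem S _ _ ht, Lp.dist_def]
      refine congrArg ENNReal.toReal (eLpNorm_congr_ae ?_)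
      filter_upwards [coeFn_slice ht] with x hx
      rw [Pi.sub_apply, hx]
    · rw [piecewise_eq_of_notMem S _ _ ht, slice, dif_neg ht]
  rw [hdist]
  have hfc : Measurable fun p : α × β => f p - c p.1 :=
    hf.sub ((Lp.stronglyMeasurable c).measurable.comp measurable_fst)
  exact Measurable.piecewise hS (hnorm hfc).ennreal_toReal measurable_const

variable [SFinite ν] {F G : Lp ℝ 2 (μ.prod ν)}

theorem ae_ae_swap_of_ae_prod {P : α × β → Prop} (h : ∀ᵐ p ∂μ.prod ν, P p) :
    ∀ᵐ t ∂ν, ∀ᵐ x ∂μ, P (x, t) :=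
  Measure.ae_ae_of_ae_prod (Measure.measurePreserving_swap.quasiMeasurePreserving.ae h)

theorem coeFn_slice_ae (F : Lp ℝ 2 (μ.prod ν)) :
    ∀ᵐ t ∂ν, slice μ F t =ᵐ[μ] fun x => F (x, t) := by
  filter_upwards [(integrable_mul_coeFn F F).prod_left_ae] with t ht
  refine coeFn_slice ?_
  rw [memLp_two_iff_integrable_sq
    (aestronglyMeasurable_prodMk_left (Lp.stronglyMeasurable F).measurable t)]
  simpa only [sq] using ht

theorem inner_slice_ae (F : Lp ℝ 2 (μ.prod ν)) :
    ∀ᵐ t ∂ν, ∀ z : Lp ℝ 2 μ, ⟪slice μ F t, z⟫ = ∫ x, F (x, t) * z x ∂μ := by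
  filter_upwards [coeFn_slice_ae F] with t ht z
  rw [inner_Lp_eq_integral]
  refine integral_congr_ae ?_
  filter_upwards [ht] with x hx
  rw [hx]

theorem inner_slice_slice_ae (F G : Lp ℝ 2 (μ.prod ν)) :
    ∀ᵐ t ∂ν, ⟪slice μ F t, slice μ G t⟫ = ∫ x, F (x, t) * G (x, t) ∂μ := by
  filter_upwards [inner_slice_ae F, coeFn_slice_ae G] with t hF hG
  rw [hF]
  refine integral_congr_ae ?_
  filter_upwards [hG] with x hx
  rw [hx]

theorem integral_inner_slice (F G : Lp ℝ 2 (μ.prod ν)) :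
    ∫ t, ⟪slice μ F t, slice μ G t⟫ ∂ν = ⟪F, G⟫ := by
  rw [inner_Lp_eq_integral, integral_prod_symm _ (integrable_mul_coeFn F G)]
  exact integral_congr_ae (inner_slice_slice_ae F G)

variable [IsSeparable μ]

theorem memLp_slice (F : Lp ℝ 2 (μ.prod ν)) : MemLp (slice μ F) 2 ν := by
  have hm : AEStronglyMeasurable (slice μ F) ν :=
    (stronglyMeasurable_slice (Lp.stronglyMeasurable F).measurable).aestronglyMeasurable
  rw [memLp_two_iff_integrable_sq_norm hm]
  refine (integrable_mul_coeFn F F).integral_prod_right.congr ?_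
  filter_upwards [inner_slice_slice_ae F F] with t ht
  rw [← ht, real_inner_self_eq_norm_sq]

omit [IsSeparable μ] in
theorem slice_add_ae (F G : Lp ℝ 2 (μ.prod ν)) :
    ∀ᵐ t ∂ν, slice μ (F + G : Lp ℝ 2 (μ.prod ν)) t = slice μ F t + slice μ G t := by
  filter_upwards [coeFn_slice_ae F, coeFn_slice_ae G, coeFn_slice_ae (F + G),
    ae_ae_swap_of_ae_prod (Lp.coeFn_add F G)] with t hF hG hFG hadd
  refine Lp.ext ?_
  filter_upwards [hF, hG, hFG, hadd, Lp.coeFn_add (slice μ F t) (slice μ G t)]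
    with x hF hG hFG hadd hadd'
  rw [hadd', hFG, hadd, Pi.add_apply, Pi.add_apply, hF, hG]

omit [IsSeparable μ] in
theorem slice_smul_ae (c : ℝ) (F : Lp ℝ 2 (μ.prod ν)) :
    ∀ᵐ t ∂ν, slice μ (c • F : Lp ℝ 2 (μ.prod ν)) t = c • slice μ F t := by
  filter_upwards [coeFn_slice_ae F, coeFn_slice_ae (c • F),
    ae_ae_swap_of_ae_prod (Lp.coeFn_smul c F)] with t hF hcF hsmul
  refine Lp.ext ?_
  filter_upwards [hF, hcF, hsmul, Lp.coeFn_smul c (slice μ F t)] with x hF hcF hsmul hsmul'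
  rw [hsmul', hcF, hsmul, Pi.smul_apply, Pi.smul_apply, hF]

/-- The isometry `L²(μ × ν) → L²(ν; L²(μ))`. -/
def sliceₗᵢ (μ : Measure α) [SFinite μ] [IsSeparable μ] (ν : Measure β) [SFinite ν] :
    Lp ℝ 2 (μ.prod ν) →ₗᵢ[ℝ] Lp (Lp ℝ 2 μ) 2 ν :=
  LinearMap.isometryOfInner
    { toFun := fun F => (memLp_slice F).toLp _
      map_add' := fun F G => by
        rw [← MemLp.toLp_add]
        exact (MemLp.toLp_eq_toLp_iff _ _).mpr (slice_add_ae F G)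
      map_smul' := fun c F => by
        rw [RingHom.id_apply, ← MemLp.toLp_const_smul]
        exact (MemLp.toLp_eq_toLp_iff _ _).mpr (slice_smul_ae c F) }
    fun F G => by
      rw [← integral_inner_slice, L2.inner_def]
      refine integral_congr_ae ?_
      filter_upwards [(memLp_slice F).coeFn_toLp, (memLp_slice G).coeFn_toLp] with t hF hG
      exact congrArg₂ (inner ℝ) hF hG

theorem coeFn_sliceₗᵢ (F : Lp ℝ 2 (μ.prod ν)) : sliceₗᵢ μ ν F =ᵐ[ν] slice μ F :=
  (memLp_slice F).coeFn_toLp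

theorem eq_zero_of_slice_ae_eq_zero (h : ∀ᵐ t ∂ν, slice μ F t = 0) : F = 0 := by
  refine (map_eq_zero_iff _ (sliceₗᵢ μ ν).injective).mp ?_
  rw [Lp.eq_zero_iff_ae_eq_zero]
  exact (coeFn_sliceₗᵢ F).trans h

omit [MeasureTheory.IsSeparable μ] in
theorem exists_slice_ae_eq_indicator {s : Set β} (hs : MeasurableSet s) (hνs : ν s ≠ ⊤)
    (z : Lp ℝ 2 μ) :
    ∃ F : Lp ℝ 2 (μ.prod ν), slice μ F =ᵐ[ν] s.indicator fun _ => z := by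
  have hg : MemLp (fun p : α × β => z p.1 * s.indicator (1 : β → ℝ) p.2) 2 (μ.prod ν) := by
    have hs_memLp : MemLp (s.indicator (1 : β → ℝ)) 2 ν := memLp_indicator_const 2 hs 1 (Or.inr hνs)
    refine (memLp_two_iff_integrable_sq ((Lp.memLp z).1.comp_fst.mul hs_memLp.1.comp_snd)).mpr ?_
    simp only [Pi.mul_apply, mul_pow]
    exact (Lp.memLp z).integrable_sq.mul_prod hs_memLp.integrable_sq
  refine ⟨hg.toLp _, ?_⟩
  filter_upwards [coeFn_slice_ae (hg.toLp _), ae_ae_swap_of_ae_prod hg.coeFn_toLp]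
    with t hslice htoLp
  refine Lp.ext ?_
  by_cases ht : t ∈ s
  · filter_upwards [hslice, htoLp] with x hx hx'
    rw [hx, hx', indicator_of_mem ht, indicator_of_mem ht, Pi.one_apply, mul_one]
  · filter_upwards [hslice, htoLp, Lp.coeFn_zero ℝ 2 μ] with x hx hx' hx0
    rw [hx, hx', indicator_of_notMem ht, indicator_of_notMem ht, hx0, mul_zero, Pi.zero_apply]

theorem sliceₗᵢ_surjective : Function.Surjective (sliceₗᵢ μ ν) := by
  refine Lp.induction ENNReal.ofNat_ne_top _ (fun z s hs hνs => ?_) ?_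
    (sliceₗᵢ μ ν).isometry.isClosedEmbedding.isClosed_range
  · obtain ⟨F, hF⟩ := exists_slice_ae_eq_indicator hs hνs.ne z
    refine ⟨F, Lp.ext ?_⟩
    rw [Lp.simpleFunc.coe_indicatorConst]
    exact (coeFn_sliceₗᵢ F).trans (hF.trans indicatorConstLp_coeFn.symm)
  · rintro _ _ _ _ - ⟨F, hF⟩ ⟨G, hG⟩
    exact ⟨F + G, by rw [map_add, hF, hG]⟩

theorem exists_slice_ae_eq {u : β → Lp ℝ 2 μ} (hu : MemLp u 2 ν) :
    ∃ F : Lp ℝ 2 (μ.prod ν), slice μ F =ᵐ[ν] u := by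
  obtain ⟨F, hF⟩ := sliceₗᵢ_surjective (hu.toLp u)
  exact ⟨F, (coeFn_sliceₗᵢ F).symm.trans (hF ▸ hu.coeFn_toLp)⟩

end Slice

/-! ### Multiplication by a bounded potential -/

/-- Multiplication by an essentially bounded function on `L²(μ)`. -/
def mulL {α : Type*} [MeasurableSpace α] {μ : Measure α} (f : Lp ℝ ∞ μ) :
    Lp ℝ 2 μ →L[ℝ] Lp ℝ 2 μ :=
  (ContinuousLinearMap.mul ℝ ℝ).holderL μ ∞ 2 2 f

theorem coeFn_mulL {α : Type*} [MeasurableSpace α] {μ : Measure α} (f : Lp ℝ ∞ μ)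
    (z : Lp ℝ 2 μ) : mulL f z =ᵐ[μ] fun x => f x * z x :=
  (ContinuousLinearMap.mul ℝ ℝ).coeFn_holder f z

section

variable {T : ℝ}

/-- The representative of `A ∈ L^∞(Q_T)` truncated at height `‖A‖`, which makes all its time slices
bounded by `‖A‖`. -/
def clamp (A : LinftyQ T) (p : ℝ × ℝ) : ℝ := max (-‖A‖) (min ‖A‖ (A p))

theorem measurable_clamp (A : LinftyQ T) : Measurable (clamp A) :=
  measurable_const.max (measurable_const.min (Lp.stronglyMeasurable A).measurable)

theorem abs_clamp_le (A : LinftyQ T) (p : ℝ × ℝ) : |clamp A p| ≤ ‖A‖ :=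
  abs_le.mpr ⟨le_max_left _ _, max_le (neg_le_self (norm_nonneg A)) (min_le_left _ _)⟩

theorem clamp_ae_eq (A : LinftyQ T) : clamp A =ᵐ[volQ T] A := by
  filter_upwards [ae_norm_coeFn_le_norm A] with p hp
  obtain ⟨hlower, hupper⟩ := abs_le.mp hp
  rw [clamp, min_eq_right hupper, max_eq_right hlower]

theorem memLp_clamp (A : LinftyQ T) (t : ℝ) : MemLp (fun x => clamp A (x, t)) ∞ volΩ :=
  memLp_top_of_bound (aestronglyMeasurable_prodMk_left (measurable_clamp A) t) ‖A‖
    (Eventually.of_forall fun _ => abs_clamp_le A _)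

/-- Multiplication by `A(·,t)` on `L²(Ω)`. -/
def potential (A : LinftyQ T) (t : ℝ) : L2Ω →L[ℝ] L2Ω := mulL ((memLp_clamp A t).toLp _)

theorem coeFn_potential (A : LinftyQ T) (t : ℝ) (z : L2Ω) :
    potential A t z =ᵐ[volΩ] fun x => clamp A (x, t) * z x := by
  filter_upwards [coeFn_mulL ((memLp_clamp A t).toLp _) z, (memLp_clamp A t).coeFn_toLp]
    with x hmul hclamp
  exact hmul.trans (congrArg (· * z x) hclamp)

theorem potential_eq_slice (A : LinftyQ T) (t : ℝ) (z : L2Ω) :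
    potential A t z = slice volΩ (fun p => clamp A p * z p.1) t :=
  Lp.ext <| (coeFn_potential A t z).trans
    (coeFn_slice (f := fun p => clamp A p * z p.1)
      ((memLp_congr_ae (coeFn_potential A t z)).mp (Lp.memLp _))).symm

theorem isPotential_potential (A : LinftyQ T) : IsPotential (potential A) ‖A‖ where
  nonneg := norm_nonneg A
  inner_map_left t y z := by
    rw [inner_Lp_eq_integral, inner_Lp_eq_integral]
    refine integral_congr_ae ?_
    filter_upwards [coeFn_potential A t y, coeFn_potential A t z] with x hy hz
    rw [hy, hz]
    ring
  norm_map_le t z := by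
    refine Lp.norm_le_mul_norm_of_ae_le_mul ?_
    filter_upwards [coeFn_potential A t z] with x hx
    rw [hx, norm_mul]
    exact mul_le_mul_of_nonneg_right (abs_clamp_le A _) (norm_nonneg _)
  stronglyMeasurable z := by
    simp only [potential_eq_slice]
    exact stronglyMeasurable_slice
      ((measurable_clamp A).mul ((Lp.stronglyMeasurable z).measurable.comp measurable_fst))

theorem inner_potential_ae (A : LinftyQ T) :
    ∀ᵐ t ∂volTime T, ∀ y z : L2Ω, ⟪potential A t y, z⟫ = ∫ x, A (x, t) * y x * z x ∂volΩ := by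
  filter_upwards [ae_ae_swap_of_ae_prod (clamp_ae_eq A)] with t ht y z
  rw [inner_Lp_eq_integral]
  refine integral_congr_ae ?_
  filter_upwards [ht, coeFn_potential A t y] with x hclamp hpot
  rw [hpot, hclamp]

end

/-! ### Backward weak solutions as mild solutions -/

section Backward

variable {T : ℝ} {A : LinftyQ T} {g : L2Q T} {w : ℝ → H10} {wt : ℝ → L2Ω}
  {U : ℝ → WithLp 2 (L2Ω × L2Ω) →L[ℝ] WithLp 2 (L2Ω × L2Ω)}

theorem fst_waveOp_toLp_neg_dx (v : L2Ω) (z : H10) :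
    (waveOp primitive (WithLp.toLp 2 (v, -z.dx))).fst = H10.inclL2 z :=
  (congrArg Neg.neg (map_neg primitive z.dx)).trans ((neg_neg _).trans (primitive_dx z))

/-- The force `g - A w` for which a solution `w` of the backward problem solves the wave equation
without potential. -/
def forcing (A : LinftyQ T) (g : L2Q T) (w : ℝ → H10) (t : ℝ) : L2Ω :=
  slice volΩ g t - potential A t (H10.inclL2 (w t))

theorem variational_iff_ae (A : LinftyQ T) (g : L2Q T) (w : ℝ → H10) :
    ∀ᵐ t ∂volTime T, ∀ ψ : Hm1,
      (∀ z : H10, ψ z + (∫ x, (w t).dx x * z.dx x ∂volΩ)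
          + (∫ x, A (x, t) * (w t).toL2 x * z.toL2 x ∂volΩ)
        = ∫ x, g (x, t) * z.toL2 x ∂volΩ) ↔
      ψ = riesz (-(w t).dx + (primitive†) (forcing A g w t)) := by
  filter_upwards [inner_slice_ae g, inner_potential_ae A] with t hg hA ψ
  rw [ContinuousLinearMap.ext_iff]
  refine forall_congr' fun z => ?_
  rw [← hg, ← hA, ← inner_Lp_eq_integral, riesz_apply, inner_add_left, inner_neg_left,
    ContinuousLinearMap.adjoint_inner_left, primitive_dx, forcing, inner_sub_left,
    H10.inclL2_apply, H10.inclL2_apply]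
  constructor <;> intro h <;> linarith

namespace IsBackwardWeakSolution

theorem memLp_forcing (h : IsBackwardWeakSolution T A g w wt) :
    MemLp (forcing A g w) 2 (volTime T) :=
  (memLp_slice g).sub ((isPotential_potential A).memLp
    (memLp_of_continuousOn (H10.inclL2.continuous.comp_continuousOn h.continuousOn)))

theorem continuousOn_dx (h : IsBackwardWeakSolution T A g w wt) :
    ContinuousOn (fun t => (w t).dx) (Icc 0 T) :=
  H10.dxEquiv.continuous.comp_continuousOn h.continuousOn

theorem hasWeakDeriv_adjoint_deriv (h : IsBackwardWeakSolution T A g w wt) :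
    HasWeakDeriv 0 T (fun t => (primitive†) (wt t))
      (fun t => -(w t).dx + (primitive†) (forcing A g w t)) := by
  obtain ⟨wtt, -, hweak, hvar⟩ := h.variational
  have hriesz : HasWeakDeriv 0 T (fun t => riesz ((primitive†) (wt t)))
      (fun t => riesz (-(w t).dx + (primitive†) (forcing A g w t))) := by
    intro η hη
    simp only [← toHm1_eq_riesz]
    refine (hweak η hη).trans (congrArg Neg.neg (integral_congr_ae ?_))
    filter_upwards [hvar, variational_iff_ae A g w] with t ht hiff
    rw [(hiff _).mp ht]
  have hwt : IntegrableOn (fun t => riesz ((primitive†) (wt t))) (Ioo 0 T) :=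
    integrableOn_Ioo_of_continuousOn (riesz.continuous.comp_continuousOn
      ((primitive†).continuous.comp_continuousOn h.continuousOn_deriv))
  have hrhs : IntegrableOn (fun t => -(w t).dx + (primitive†) (forcing A g w t)) (Ioo 0 T) :=
    (integrableOn_Ioo_of_continuousOn h.continuousOn_dx.neg).add
      ((primitive†).integrable_comp (h.memLp_forcing.integrable one_le_two))
  simpa using hriesz.clm_comp (riesz.symm : Hm1 →L[ℝ] L2Ω) hwt
    ((riesz : L2Ω →L[ℝ] Hm1).integrable_comp hrhs)

theorem eq_backward (h : IsBackwardWeakSolution T A g w wt)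
    (hU : IsUnitaryGroup (waveOp primitive) U) {t : ℝ} (ht : t ∈ Icc 0 T) :
    WithLp.toLp 2 (wt t, -(w t).dx) = backward U T (source T (forcing A g w)) t := by
  refine eq_backward_of_hasWeakDeriv (Y := fun s => WithLp.toLp 2 (wt s, -(w s).dx)) hU
    (injective_waveOp injective_primitive injective_adjoint_primitive)
    (h.memLp_forcing.integrable one_le_two) ?_ (fun s hs => ?_) h.hasWeakDeriv_adjoint_deriv ?_ ht
  · exact (WithLp.prodContinuousLinearEquiv 2 ℝ L2Ω L2Ω).symm.continuous.comp_continuousOn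
      (h.continuousOn_deriv.prodMk h.continuousOn_dx.neg)
  · simp only [fst_waveOp_toLp_neg_dx]
    exact h.hasDerivWithinAt s hs
  · rw [h.final, h.final_deriv, map_zero, neg_zero]
    rfl

theorem slice_eq (h : IsBackwardWeakSolution T A g w wt)
    (hU : IsUnitaryGroup (waveOp primitive) U) {t : ℝ} (ht : t ∈ Icc 0 T) :
    slice volΩ g t = forcing A g w t
      + potential A t (waveOp primitive (backward U T (source T (forcing A g w)) t)).fst := by
  rw [← h.eq_backward hU ht, fst_waveOp_toLp_neg_dx, forcing, sub_add_cancel]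

end IsBackwardWeakSolution

theorem isBackwardWeakSolution_backward (hU : IsUnitaryGroup (waveOp primitive) U) (hT : 0 ≤ T)
    {F : ℝ → L2Ω} (hF : MemLp F 2 (volTime T))
    (hg : ∀ᵐ t ∂volTime T, slice volΩ g t
      = F t + potential A t (waveOp primitive (backward U T (source T F) t)).fst) :
    IsBackwardWeakSolution T A g
      (fun t => H10.dxEquiv.symm (-(backward U T (source T F) t).snd))
      (fun t => (backward U T (source T F) t).fst) := by
  have hFi : IntegrableOn F (Ioo 0 T) := hF.integrable one_le_two
  have hbc := continuous_backward hU T (integrable_source hFi)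
  have hfst : Continuous fun s => (backward U T (source T F) s).fst :=
    (WithLp.fstL 2 ℝ L2Ω L2Ω).continuous.comp hbc
  have hsnd : Continuous fun s => (backward U T (source T F) s).snd :=
    (WithLp.sndL 2 ℝ L2Ω L2Ω).continuous.comp hbc
  have hfinal := backward_final hU (integrable_source hFi) T
  have hincl : ∀ t, H10.inclL2 (H10.dxEquiv.symm (-(backward U T (source T F) t).snd))
      = (waveOp primitive (backward U T (source T F) t)).fst := fun t => by
    rw [inclL2_dxEquiv_symm, map_neg, fst_waveOp]
  have hrhs : MemLp (fun t => (backward U T (source T F) t).snd + (primitive†) (F t)) 2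
      (volTime T) :=
    (memLp_of_continuousOn hsnd.continuousOn).add ((primitive†).comp_memLp' hF)
  exact
    { continuousOn := (H10.dxEquiv.symm.continuous.comp hsnd.neg).continuousOn
      continuousOn_deriv := hfst.continuousOn
      hasDerivWithinAt := fun t ht => by
        simp only [hincl]
        exact hasDerivWithinAt_fst_waveOp_backward hU hFi ht
      variational := by
        refine ⟨fun t => riesz ((backward U T (source T F) t).snd + (primitive†) (F t)),
          (riesz : L2Ω →L[ℝ] Hm1).comp_memLp' hrhs, ?_, ?_⟩
        · simp only [toHm1_eq_riesz]
          exact (hasWeakDeriv_adjoint_fst_backward hU hT hFi).clm_comp (riesz : L2Ω →L[ℝ] Hm1)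
            (integrableOn_Ioo_of_continuousOn ((primitive†).continuous.comp hfst).continuousOn)
            (hrhs.integrable one_le_two)
        · filter_upwards [hg, variational_iff_ae A g _] with t ht hiff
          refine (hiff _).mpr (congrArg riesz ?_)
          rw [forcing, ht, hincl, add_sub_cancel_right, ← H10.dxEquiv_apply,
            LinearIsometryEquiv.apply_symm_apply, neg_neg]
      final := by rw [hfinal, WithLp.zero_snd, neg_zero, map_zero]
      final_deriv := by rw [hfinal, WithLp.zero_fst] }

end Backward

/-! ### Transposition solutions -/

section Transposition

variable {T : ℝ} {A : LinftyQ T} {φ : L2Q T}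
  {U : ℝ → WithLp 2 (L2Ω × L2Ω) →L[ℝ] WithLp 2 (L2Ω × L2Ω)}

theorem integral_integral_zero_mul (w : ℝ → H10) :
    ∫ t, ∫ x, (0 : L2Q T) (x, t) * (w t).toL2 x ∂volΩ ∂volTime T = 0 := by
  refine integral_eq_zero_of_ae ?_
  filter_upwards [ae_ae_swap_of_ae_prod (Lp.coeFn_zero ℝ 2 (volQ T))] with t ht
  refine integral_eq_zero_of_ae ?_
  filter_upwards [ht] with x hx
  rw [hx, Pi.zero_apply, zero_mul, Pi.zero_apply]

section Solution

variable {X : WithLp 2 (L2Ω × L2Ω)} {Y : ℝ → WithLp 2 (L2Ω × L2Ω)}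

theorem isTranspositionSolution_of_slice_ae_eq (hU : IsUnitaryGroup (waveOp primitive) U)
    (hT : 0 ≤ T) (hYc : Continuous Y)
    (hY : ∀ t ∈ Icc 0 T,
      Y t = U t X - duhamel primitive U T (fun s => potential A s (Y s).fst) t)
    (hφ : slice volΩ φ =ᵐ[volTime T] fun t => (Y t).fst) :
    IsTranspositionSolution T A 0 X.fst (riesz X.snd) φ := by
  intro g w wt hw
  have hduality := (isPotential_potential A).integral_inner_eq_neg_inner_backward hU hT hYc hY
    hw.memLp_forcing
  have hinner : ∫ p, φ p * g p ∂volQ T = -⟪X, WithLp.toLp 2 (wt 0, -(w 0).dx)⟫ := by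
    rw [hw.eq_backward hU (left_mem_Icc.mpr hT), ← hduality, ← inner_Lp_eq_integral,
      ← integral_inner_slice]
    refine integral_congr_ae ?_
    filter_upwards [hφ, ae_restrict_mem measurableSet_Ioo] with t hφt ht
    rw [hφt, hw.slice_eq hU (Ioo_subset_Icc_self ht)]
  rw [hinner, integral_integral_zero_mul, zero_add, riesz_apply, ← inner_Lp_eq_integral,
    WithLp.prod_inner_apply, WithLp.ofLp_fst, WithLp.ofLp_snd, inner_neg_right, neg_add_rev,
    neg_neg, ← sub_eq_add_neg]

theorem isContinuousRepresentative_of_slice_ae_eq (hU : IsUnitaryGroup (waveOp primitive) U)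
    (hYc : Continuous Y)
    (hY : ∀ t ∈ Icc 0 T,
      Y t = U t X - duhamel primitive U T (fun s => potential A s (Y s).fst) t)
    (hφ : slice volΩ φ =ᵐ[volTime T] fun t => (Y t).fst) :
    IsContinuousRepresentative T φ (fun t => (Y t).fst) (fun t => riesz (Y t).snd) where
  ae_eq := by
    filter_upwards [hφ, coeFn_slice_ae φ] with t hφt hslice
    rw [hφt] at hslice
    exact hslice.symm
  continuousOn := ((WithLp.fstL 2 ℝ L2Ω L2Ω).continuous.comp hYc).continuousOn
  continuousOn_deriv :=
    (riesz.continuous.comp ((WithLp.sndL 2 ℝ L2Ω L2Ω).continuous.comp hYc)).continuousOn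
  hasDerivWithinAt t ht := by
    simp only [toHm1_eq_riesz]
    exact (riesz : L2Ω →L[ℝ] Hm1).hasFDerivAt.comp_hasDerivWithinAt t
      ((isPotential_potential A).hasDerivWithinAt_adjoint_fst hU hYc hY ht)

end Solution

theorem IsTranspositionSolution.unique (hU : IsUnitaryGroup (waveOp primitive) U) (hT : 0 ≤ T)
    {B ψ : L2Q T} {φ₀ : L2Ω} {φ₁ : Hm1} (hψ : IsTranspositionSolution T A B φ₀ φ₁ ψ)
    (hφ : IsTranspositionSolution T A B φ₀ φ₁ φ) : ψ = φ := by
  have hm := isPotential_potential A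
  refine sub_eq_zero.mp (eq_zero_of_slice_ae_eq_zero
    (hm.ae_eq_zero_of_forall_integral_inner hU hT (memLp_slice (ψ - φ)) fun F hF => ?_))
  have hw : Continuous fun t => (waveOp primitive (backward U T (source T F) t)).fst :=
    (WithLp.fstL 2 ℝ L2Ω L2Ω).continuous.comp ((waveOp primitive).continuous.comp
      (continuous_backward hU T (integrable_source (hF.integrable one_le_two))))
  obtain ⟨g, hg⟩ := exists_slice_ae_eq
    (hF.add (hm.memLp (memLp_of_continuousOn hw.continuousOn)))
  have hsol := isBackwardWeakSolution_backward hU hT hF hg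
  have horth : ⟪ψ - φ, g⟫ = 0 := by
    rw [inner_sub_left, inner_Lp_eq_integral, inner_Lp_eq_integral, sub_eq_zero]
    exact (hψ g _ _ hsol).trans (hφ g _ _ hsol).symm
  rw [← integral_inner_slice] at horth
  refine Eq.trans (integral_congr_ae ?_) horth
  filter_upwards [hg] with t ht
  exact congrArg (inner ℝ _) ht.symm

end Transposition

end WaveTransposition

end

open WaveTransposition in
theorem theorem5 (T : ℝ) (hT : 0 < T) :
    ∃ C : ℝ, 0 < C ∧ ∀ (A : LinftyQ T) (φ₀ : L2Ω) (φ₁ : Hm1),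
      ∃ φ : L2Q T, IsTranspositionSolution T A 0 φ₀ φ₁ φ ∧
        (∀ ψ : L2Q T, IsTranspositionSolution T A 0 φ₀ φ₁ ψ → ψ = φ) ∧
        ∃ (u : ℝ → L2Ω) (ut : ℝ → Hm1), IsContinuousRepresentative T φ u ut ∧
          ∀ t ∈ Set.Icc (0 : ℝ) T,
            ‖u t‖ + ‖ut t‖
              ≤ C * Real.exp (C * Real.sqrt ‖A‖) * Real.sqrt (‖φ₀‖ ^ 2 + ‖φ₁‖ ^ 2) := by
  refine ⟨3 + 3 * T, by positivity, fun A φ₀ φ₁ => ?_⟩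
  obtain ⟨U, hU⟩ := exists_isUnitaryGroup (waveOp_mem_skewAdjoint primitive)
    (injective_waveOp injective_primitive injective_adjoint_primitive)
  obtain ⟨X, rfl, hX⟩ : ∃ X : WithLp 2 (L2Ω × L2Ω), X.fst = φ₀ ∧ riesz X.snd = φ₁ :=
    ⟨WithLp.toLp 2 (φ₀, riesz.symm φ₁), rfl, riesz.apply_symm_apply φ₁⟩
  obtain ⟨Y, hYc, hY⟩ := (isPotential_potential A).exists_eq_map_sub_duhamel hU hT.le X
  have hu : MemLp (fun t => (Y t).fst) 2 (volTime T) :=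
    memLp_of_continuousOn ((WithLp.fstL 2 ℝ L2Ω L2Ω).continuous.comp hYc).continuousOn
  obtain ⟨φ, hφ⟩ := exists_slice_ae_eq hu
  have hsol : IsTranspositionSolution T A 0 X.fst φ₁ φ :=
    hX ▸ isTranspositionSolution_of_slice_ae_eq hU hT.le hYc hY hφ
  refine ⟨φ, hsol, fun ψ hψ => hψ.unique hU hT.le hsol, fun t => (Y t).fst,
    fun t => riesz (Y t).snd, isContinuousRepresentative_of_slice_ae_eq hU hYc hY hφ,
    fun t ht => ?_⟩
  rw [← hX, riesz.norm_map, riesz.norm_map, ← WithLp.prod_norm_eq_of_L2]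
  exact (isPotential_potential A).norm_fst_add_norm_snd_le hU norm_primitive_le hT.le hYc hY ht
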